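/- For a finite simple graph $G=(V,E)$ and a coloring $c':V\to[k]$, a vertex is \emph{happy} if all its neighbors have its color. In the problem \textsc{$k$-MHV} (\textsc{Maximum Happy Vertices}) an instance consists of a finite simple graph $G=(V,E)$, a partial coloring $c:S\to[k]$ with $S\subseteq V$, and an integer $\ell$; the question is whether there is a coloring $c':V\to[k]$ with $c'|_S=c$ under which at least $\ell$ vertices are happy. Two vertices $u,v$ have the same type if $N(u)\setminus\{v\}=N(v)\setminus\{u\}$, and the neighborhood diversity of $G$ is the least $t$ such that $V$ can be partitioned into $t$ nonempty sets in each of which any two vertices have the same type. \textbf{Theorem.} For every $k\ge 1$, \textsc{$k$-MHV} can be solved in time $O^*(2^t)$, where $t$ is the neighborhood diversity of the input graph. That is, for every $k\ge1$ there are a random access machine program and a polynomial $p$ such that, on every instance $(G,c,\ell)$ with $n$ vertices (given by $n$, the adjacency matrix, the list of the colors of the vertices, and $\ell$), the program halts with the correct yes/no answer within time $2^{t}\cdot p(n+b)$, where time is measured by the logarithmic cost criterion (an operation on numbers costs the number of their bits, up to constant factors) and $b$ is the number of binary digits of $|\ell|$. (Thus the time is $2^t\cdot n^{O(1)}$ if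 $|\ell|\le n$.) -/

import Mathlib

namespace HappyColoring

/-! ### Happy vertices and the problem k-MHV -/

section Graphs

variable {V : Type*}

/-- A vertex is happy under a coloring if all its neighbors have its own color. -/
def IsHappy {κ : Type*} (G : SimpleGraph V) (c : V → κ) (v : V) : Prop :=
  ∀ u : V, G.Adj v u → c u = c v

/-- A partial coloring is a map to `Option κ`, where `none` means "uncolored".  A full coloring
extends it if the two agree on all precolored vertices. -/
def Extends {κ : Type*} (c' : V → κ) (c : V → Option κ) : Prop :=
  ∀ (v : V) (i : κ), c v = some i → c' v = i

/-- Two vertices have the same type if `N(u) \ {v} = N(v) \ {u}`. -/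
def SameType (G : SimpleGraph V) (u v : V) : Prop :=
  G.neighborSet u \ {v} = G.neighborSet v \ {u}

/-- `G` has a type partition with exactly `t` (nonempty) sets. -/
def HasTypePartition [Fintype V] [DecidableEq V] (G : SimpleGraph V) (t : ℕ) : Prop :=
  ∃ P : Finpartition (Finset.univ : Finset V),
    P.parts.card = t ∧ ∀ A ∈ P.parts, ∀ u ∈ A, ∀ v ∈ A, SameType G u v

/-- The neighborhood diversity: the least number of sets in a type partition (one always exists,
the partition into singletons). -/
noncomputable def neighborhoodDiversity [Fintype V] [DecidableEq V] (G : SimpleGraph V) : ℕ :=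
  sInf {t : ℕ | HasTypePartition G t}

end Graphs

/-- An instance of k-MHV: a finite simple graph on the vertices `0, …, n - 1`, a partial coloring
with colors `0, …, k - 1`, and an integer `ℓ`. -/
structure MHVInstance (k : ℕ) where
  n : ℕ
  G : SimpleGraph (Fin n)
  c : Fin n → Option (Fin k)
  ℓ : ℤ

/-- The question of k-MHV: does some extended full coloring have at least `ℓ` happy vertices? -/
def MHVInstance.IsYes {k : ℕ} (I : MHVInstance k) : Prop :=
  ∃ c' : Fin I.n → Fin k, Extends c' I.c ∧ I.ℓ ≤ (({v | IsHappy I.G c' v} : Set (Fin I.n)).ncard : ℤ)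

/-- The size of an instance: the number of vertices plus the bit length of `ℓ`. -/
def MHVInstance.size {k : ℕ} (I : MHVInstance k) : ℕ :=
  I.n + Nat.size I.ℓ.natAbs

/-! ### Random access machines with logarithmic cost

Programs are structured programs over natural-number registers and natural-number arrays that
are unbounded and randomly accessible.  A program mentions finitely many registers and arrays, by
fixed names. -/

/-- The memory of the machine. -/
structure Store where
  reg : ℕ → ℕ
  arr : ℕ → ℕ → ℕ

/-- `r := a`. -/
def Store.setReg (s : Store) (r a : ℕ) : Store :=
  { s with reg := Function.update s.reg r a }

/-- `A[i] := a`. -/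
def Store.setArr (s : Store) (A i a : ℕ) : Store :=
  { s with arr := Function.update s.arr A (Function.update (s.arr A) i a) }

/-- Expressions: constants, registers, array access `A[e]`, and arithmetic on `ℕ` (`sub` is
truncated, `div` rounds down and gives `0` for the divisor `0`). -/
inductive Expr where
  | const (a : ℕ)
  | reg (r : ℕ)
  | get (A : ℕ) (e : Expr)
  | add (e₁ e₂ : Expr)
  | sub (e₁ e₂ : Expr)
  | mul (e₁ e₂ : Expr)
  | div (e₁ e₂ : Expr)

/-- The value of an expression. -/
def Expr.eval (s : Store) : Expr → ℕ
  | .const a => a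
  | .reg r => s.reg r
  | .get A e => s.arr A (e.eval s)
  | .add e₁ e₂ => e₁.eval s + e₂.eval s
  | .sub e₁ e₂ => e₁.eval s - e₂.eval s
  | .mul e₁ e₂ => e₁.eval s * e₂.eval s
  | .div e₁ e₂ => e₁.eval s / e₂.eval s

/-- The logarithmic cost of evaluating an expression: each operation costs one plus the bit length
of its result, and the operands (addresses included) are paid for when they are evaluated. -/
def Expr.cost (s : Store) : Expr → ℕ
  | .const a => 1 + Nat.size a
  | .reg r => 1 + Nat.size (s.reg r)
  | .get A e => e.cost s + (1 + Nat.size (s.arr A (e.eval s)))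
  | .add e₁ e₂ => e₁.cost s + e₂.cost s + (1 + Nat.size (e₁.eval s + e₂.eval s))
  | .sub e₁ e₂ => e₁.cost s + e₂.cost s + (1 + Nat.size (e₁.eval s - e₂.eval s))
  | .mul e₁ e₂ => e₁.cost s + e₂.cost s + (1 + Nat.size (e₁.eval s * e₂.eval s))
  | .div e₁ e₂ => e₁.cost s + e₂.cost s + (1 + Nat.size (e₁.eval s / e₂.eval s))

/-- Programs.  `branch e P Q` runs `P` if `e ≠ 0` and `Q` otherwise; `loop e P` repeats `P` as long
as `e ≠ 0`. -/
inductive Program where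
  | skip
  | assign (r : ℕ) (e : Expr)
  | put (A : ℕ) (i e : Expr)
  | seq (P Q : Program)
  | branch (e : Expr) (P Q : Program)
  | loop (e : Expr) (P : Program)

/-- `Exec P s T s'`: started on `s`, the program `P` halts with the memory `s'` after time exactly
`T`.  Each instruction and each test costs one plus the cost of the expressions in it. -/
inductive Exec : Program → Store → ℕ → Store → Prop where
  | skip (s : Store) : Exec .skip s 1 s
  | assign (r : ℕ) (e : Expr) (s : Store) :
      Exec (.assign r e) s (1 + e.cost s) (s.setReg r (e.eval s))
  | put (A : ℕ) (i e : Expr) (s : Store) :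
      Exec (.put A i e) s (1 + i.cost s + e.cost s) (s.setArr A (i.eval s) (e.eval s))
  | seq {P Q : Program} {s s₁ s₂ : Store} {T₁ T₂ : ℕ} :
      Exec P s T₁ s₁ → Exec Q s₁ T₂ s₂ → Exec (.seq P Q) s (T₁ + T₂) s₂
  | branch_true {e : Expr} {P Q : Program} {s s₁ : Store} {T : ℕ} :
      e.eval s ≠ 0 → Exec P s T s₁ → Exec (.branch e P Q) s (1 + e.cost s + T) s₁
  | branch_false {e : Expr} {P Q : Program} {s s₁ : Store} {T : ℕ} :
      e.eval s = 0 → Exec Q s T s₁ → Exec (.branch e P Q) s (1 + e.cost s + T) s₁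
  | loop_true {e : Expr} {P : Program} {s s₁ s₂ : Store} {T₁ T₂ : ℕ} :
      e.eval s ≠ 0 → Exec P s T₁ s₁ → Exec (.loop e P) s₁ T₂ s₂ →
        Exec (.loop e P) s (1 + e.cost s + T₁ + T₂) s₂
  | loop_false {e : Expr} {P : Program} {s : Store} :
      e.eval s = 0 → Exec (.loop e P) s (1 + e.cost s) s

open Classical in
/-- The memory that presents an instance to a program: register `0` holds `n`; registers `1` and `2`
hold the positive and the negative part of `ℓ`; array `0` holds the adjacency matrix row by row;
array `1` holds the partial coloring (`0` for an uncolored vertex, `i + 1` for the color `i`);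
everything else is `0`. -/
noncomputable def MHVInstance.input {k : ℕ} (I : MHVInstance k) : Store where
  reg r := if r = 0 then I.n else if r = 1 then I.ℓ.toNat else if r = 2 then (-I.ℓ).toNat else 0
  arr A i :=
    if A = 0 then
      (if ∃ u v : Fin I.n, i = u * I.n + v ∧ I.G.Adj u v then 1 else 0)
    else if A = 1 then
      (if h : i < I.n then (match I.c ⟨i, h⟩ with | none => 0 | some a => (a : ℕ) + 1) else 0)
    else 0

open Classical in
/-- The program `P` solves k-MHV, halting on every instance `I` within time `bound I`, with the answer
(`1` for yes, `0` for no) in register `0`. -/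
def SolvesMHV (k : ℕ) (P : Program) (bound : MHVInstance k → ℕ) : Prop :=
  ∀ I : MHVInstance k, ∃ (T : ℕ) (s : Store),
    Exec P I.input T s ∧ s.reg 0 = (if I.IsYes then 1 else 0) ∧ T ≤ bound I

end HappyColoring

/-! Guess which types contain a happy vertex of a solution, and let `S` be the union of these types.
Only the edges with an endpoint in `S` then matter, and they cut the graph into components. If each
component is given one color, used for all its uncolored vertices, then a vertex of `S` sees only
its own component. It is therefore happy as soon as it is happy when the whole graph is filled with
that color. So the best color can be chosen for each component separately, and the sum of the best
scores is attained by an actual coloring (`exists_coloring_of_score`).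

Conversely, let `c'` be a solution and `S` the union of the types of its happy vertices. Send every
unhappy vertex of `S` to a happy vertex of its type and fix all other vertices. The ends of an edge
at `S` go to vertices that are equal or adjacent, and the image of the end in `S` is happy. Hence
the `c'`-color of the image is constant on components. A happy vertex stays happy when all uncolored
vertices receive its color, so the sum of the best scores is at least the number of happy vertices
of `c'` (`exists_score_of_coloring`). Representatives of distinct types lie in distinct parts of any
type partition, so there are at most `2 ^ t` guesses (`ncard_typeReps_le`).

For the running time, the algorithm is written with counting loops only. `LProg.exists_exec` shows
once and for all that the compiled program computes `den` in time proportional to the number of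
steps times the bit length of the values. The bit lengths stay polynomial for two different reasons.
The preparation doubles a register, but takes only polynomially many steps. The search takes
exponentially many steps, but each assignment exceeds the largest value in memory by at most one. -/

namespace HappyColoring

/-! ### A language of bounded loops -/

/-- Programs whose only loops are counting loops: `count r b P` runs `P` with `r = 0, …, b - 1`,
where `b` is the value of the register `b`. -/
inductive LProg where
  | skip
  | assign (r : ℕ) (e : Expr)
  | put (A : ℕ) (i e : Expr)
  | seq (P Q : LProg)
  | branch (e : Expr) (P Q : LProg)
  | count (r b : ℕ) (P : LProg)

/-- The memory at the beginning of the `i`-th round of a counting loop with body `f`. -/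
def iterCount (f : Store → Store) (r : ℕ) : ℕ → Store → Store
  | 0, s => s.setReg r 0
  | i + 1, s => (f (iterCount f r i s)).setReg r (i + 1)

namespace LProg

/-- The effect of a program on the memory. -/
def den : LProg → Store → Store
  | skip, s => s
  | assign r e, s => s.setReg r (e.eval s)
  | put A i e, s => s.setArr A (i.eval s) (e.eval s)
  | seq P Q, s => Q.den (P.den s)
  | branch e P Q, s => if e.eval s ≠ 0 then P.den s else Q.den s
  | count r b P, s => iterCount P.den r (s.reg b) s

/-- Translation into programs of the random access machine. -/
def compile : LProg → Program
  | skip => .skip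
  | assign r e => .assign r e
  | put A i e => .put A i e
  | seq P Q => .seq P.compile Q.compile
  | branch e P Q => .branch e P.compile Q.compile
  | count r b P => .seq (.assign r (.const 0))
      (.loop (.sub (.reg b) (.reg r)) (.seq P.compile (.assign r (.add (.reg r) (.const 1)))))

/-- Does the program write to the register `x`? -/
def writes (x : ℕ) : LProg → Bool
  | skip => false
  | assign r _ => x == r
  | put _ _ _ => false
  | seq P Q => P.writes x || Q.writes x
  | branch _ P Q => P.writes x || Q.writes x
  | count r _ P => x == r || P.writes x

/-- Does the program write to the array `X`? -/
def writesArr (X : ℕ) : LProg → Bool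
  | skip => false
  | assign _ _ => false
  | put A _ _ => X == A
  | seq P Q => P.writesArr X || Q.writesArr X
  | branch _ P Q => P.writesArr X || Q.writesArr X
  | count _ _ P => P.writesArr X

/-- The bodies of counting loops change neither the counter nor the bound. -/
def wf : LProg → Bool
  | skip => true
  | assign _ _ => true
  | put _ _ _ => true
  | seq P Q => P.wf && Q.wf
  | branch _ P Q => P.wf && Q.wf
  | count r b P => r != b && !P.writes r && !P.writes b && P.wf

/-- The registers that bound loops. -/
def isBound (x : ℕ) : LProg → Bool
  | skip => false
  | assign _ _ => false
  | put _ _ _ => false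
  | seq P Q => P.isBound x || Q.isBound x
  | branch _ P Q => P.isBound x || Q.isBound x
  | count _ b P => x == b || P.isBound x

/-- No register that bounds a loop is written to. -/
def FixedBounds (P : LProg) : Prop := ∀ x, P.isBound x → P.writes x = false

/-- All values that are assigned are given by expressions with property `ok`. -/
def allExpr (ok : Expr → Bool) : LProg → Bool
  | skip => true
  | assign _ e => ok e
  | put _ _ e => ok e
  | seq P Q => P.allExpr ok && Q.allExpr ok
  | branch _ P Q => P.allExpr ok && Q.allExpr ok
  | count _ _ P => P.allExpr ok

/-- A bound for the number of steps if `N x` bounds the loop bound `x`. -/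
def steps (N : ℕ → ℕ) : LProg → ℕ
  | skip => 1
  | assign _ _ => 1
  | put _ _ _ => 1
  | seq P Q => P.steps N + Q.steps N
  | branch _ P Q => 1 + P.steps N + Q.steps N
  | count _ b P => 2 + N b * (P.steps N + 2)

end LProg

/-! ### Memory updates and framing -/

@[simp] theorem Store.setReg_reg (s : Store) (r a x : ℕ) :
    (s.setReg r a).reg x = if x = r then a else s.reg x := by
  simp [Store.setReg, Function.update_apply]

@[simp] theorem Store.setReg_arr (s : Store) (r a : ℕ) : (s.setReg r a).arr = s.arr := rfl

@[simp] theorem Store.setArr_reg (s : Store) (A i a : ℕ) : (s.setArr A i a).reg = s.reg := rfl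

theorem Store.setArr_arr (s : Store) (A i a X : ℕ) :
    (s.setArr A i a).arr X = if X = A then Function.update (s.arr A) i a else s.arr X := by
  simp [Store.setArr, Function.update_apply]

@[simp] theorem Store.setArr_arr_same (s : Store) (A i a j : ℕ) :
    (s.setArr A i a).arr A j = if j = i then a else s.arr A j := by
  simp [Store.setArr_arr, Function.update_apply]

/-- Agreement of two stores off the registers and arrays a program writes to. -/
def LProg.Frame (P : LProg) (s s' : Store) : Prop :=
  (∀ x, P.writes x = false → s'.reg x = s.reg x) ∧
    ∀ X, P.writesArr X = false → s'.arr X = s.arr X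

theorem LProg.frame_iterCount {P : LProg} (hP : ∀ s, P.Frame s (P.den s)) (r b i : ℕ) (s : Store) :
    (LProg.count r b P).Frame s (iterCount P.den r i s) := by
  induction i with
  | zero =>
    refine ⟨fun x hx => ?_, fun X _ => rfl⟩
    simp [LProg.writes] at hx
    simp [iterCount, hx]
  | succ i ih =>
    refine ⟨fun x hx => ?_, fun X hX => ?_⟩
    · have h := ih.1 x hx
      simp [LProg.writes] at hx
      simp [iterCount, hx, (hP _).1 x hx.2, h]
    · have h := ih.2 X hX
      simp only [LProg.writesArr] at hX
      simp [iterCount, (hP _).2 X hX, h]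

theorem LProg.frame_den (P : LProg) (s : Store) : P.Frame s (P.den s) := by
  induction P generalizing s with
  | skip => exact ⟨fun _ _ => rfl, fun _ _ => rfl⟩
  | assign r e =>
    refine ⟨fun x hx => ?_, fun X _ => rfl⟩
    simp [LProg.writes] at hx
    simp [LProg.den, hx]
  | put A j e =>
    refine ⟨fun x _ => rfl, fun X hX => ?_⟩
    simp [LProg.writesArr] at hX
    simp [LProg.den, Store.setArr_arr, hX]
  | seq P Q hP hQ =>
    refine ⟨fun x hx => ?_, fun X hX => ?_⟩
    · simp [LProg.writes] at hx
      simp [LProg.den, (hQ _).1 x hx.2, (hP _).1 x hx.1]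
    · simp [LProg.writesArr] at hX
      simp [LProg.den, (hQ _).2 X hX.2, (hP _).2 X hX.1]
  | branch e P Q hP hQ =>
    refine ⟨fun x hx => ?_, fun X hX => ?_⟩
    · simp [LProg.writes] at hx
      simp only [LProg.den]
      split_ifs
      · simp [(hP _).1 x hx.1]
      · simp [(hQ _).1 x hx.2]
    · simp [LProg.writesArr] at hX
      simp only [LProg.den]
      split_ifs
      · simp [(hP _).2 X hX.1]
      · simp [(hQ _).2 X hX.2]
  | count r b P hP => exact LProg.frame_iterCount hP r b _ s

theorem iterCount_reg (f : Store → Store) (r i : ℕ) (s : Store) :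
    (iterCount f r i s).reg r = i := by
  cases i <;> simp [iterCount]

/-- Induction along a counting loop. -/
theorem LProg.den_count_induct {r b : ℕ} {P : LProg} {s : Store} (I : ℕ → Store → Prop)
    (zero : I 0 (s.setReg r 0))
    (succ : ∀ i < s.reg b, ∀ s', s'.reg r = i → (LProg.count r b P).Frame s s' → I i s' →
      I (i + 1) ((P.den s').setReg r (i + 1))) :
    I (s.reg b) ((LProg.count r b P).den s) := by
  have key : ∀ i ≤ s.reg b, I i (iterCount P.den r i s) := by
    intro i
    induction i with
    | zero => exact fun _ => zero
    | succ i ih =>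
      intro hi
      exact succ i hi _ (iterCount_reg _ _ _ _)
        (LProg.frame_iterCount P.frame_den r b i s) (ih (Nat.le_of_succ_le hi))
  exact key _ le_rfl

/-! ### The running time of programs with bounded loops -/

/-- All values in the memory are at most `M`. -/
def Store.Bounded (s : Store) (M : ℕ) : Prop :=
  (∀ r, s.reg r ≤ M) ∧ ∀ A i, s.arr A i ≤ M

theorem Store.Bounded.mono {s : Store} {M M' : ℕ} (h : s.Bounded M) (hM : M ≤ M') : s.Bounded M' :=
  ⟨fun r => (h.1 r).trans hM, fun A i => (h.2 A i).trans hM⟩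

theorem Store.Bounded.setReg {s : Store} {M : ℕ} (h : s.Bounded M) (r : ℕ) {a : ℕ} (ha : a ≤ M) :
    (s.setReg r a).Bounded M := by
  refine ⟨fun x => ?_, h.2⟩
  simp only [Store.setReg_reg]
  split_ifs
  exacts [ha, h.1 x]

theorem Store.Bounded.setArr {s : Store} {M : ℕ} (h : s.Bounded M) (A i : ℕ) {a : ℕ} (ha : a ≤ M) :
    (s.setArr A i a).Bounded M := by
  refine ⟨h.1, fun X j => ?_⟩
  rw [Store.setArr_arr]
  split_ifs
  · rw [Function.update_apply]
    split_ifs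
    exacts [ha, h.2 A j]
  · exact h.2 X j

theorem size_add_le (a b : ℕ) : Nat.size (a + b) ≤ Nat.size a + Nat.size b + 1 := by
  rw [Nat.size_le]
  have ha := Nat.lt_size_self a
  have hb := Nat.lt_size_self b
  have h1 : 2 ^ a.size ≤ 2 ^ (a.size + b.size) := Nat.pow_le_pow_right (by norm_num) (by omega)
  have h2 : 2 ^ b.size ≤ 2 ^ (a.size + b.size) := Nat.pow_le_pow_right (by norm_num) (by omega)
  rw [pow_succ]
  omega

theorem size_mul_le (a b : ℕ) : Nat.size (a * b) ≤ Nat.size a + Nat.size b := by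
  rw [Nat.size_le, pow_add]
  exact Nat.mul_lt_mul'' (Nat.lt_size_self a) (Nat.lt_size_self b)

theorem size_le_self (a : ℕ) : Nat.size a ≤ a :=
  Nat.size_le.2 Nat.lt_two_pow_self

/-- Expressions over a memory with small values are cheap. -/
theorem Expr.exists_cost_le (e : Expr) : ∃ C : ℕ, ∀ (s : Store) (W : ℕ), s.Bounded W → 1 ≤ W →
    Nat.size (e.eval s) ≤ C * Nat.size W ∧ e.cost s ≤ C * Nat.size W := by
  have one (W : ℕ) (hW : 1 ≤ W) : 1 ≤ Nat.size W := Nat.size_pos.2 hW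
  induction e with
  | const a =>
    refine ⟨1 + Nat.size a, fun s W _ hW => ?_⟩
    have := one W hW
    constructor <;> simp only [Expr.eval, Expr.cost] <;> nlinarith
  | reg r =>
    refine ⟨2, fun s W hs hW => ?_⟩
    have := one W hW
    have := Nat.size_le_size (hs.1 r)
    constructor <;> simp only [Expr.eval, Expr.cost] <;> omega
  | get A e he =>
    obtain ⟨C, hC⟩ := he
    refine ⟨C + 2, fun s W hs hW => ?_⟩
    have := one W hW
    have := Nat.size_le_size (hs.2 A (e.eval s))
    have := hC s W hs hW
    constructor <;> simp only [Expr.eval, Expr.cost] <;> nlinarith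
  | add a b ha hb =>
    obtain ⟨C, hC⟩ := ha
    obtain ⟨D, hD⟩ := hb
    refine ⟨2 * C + 2 * D + 2, fun s W hs hW => ?_⟩
    have := one W hW
    have := size_add_le (a.eval s) (b.eval s)
    have := hC s W hs hW
    have := hD s W hs hW
    constructor <;> simp only [Expr.eval, Expr.cost] <;> nlinarith
  | sub a b ha hb =>
    obtain ⟨C, hC⟩ := ha
    obtain ⟨D, hD⟩ := hb
    refine ⟨2 * C + 2 * D + 2, fun s W hs hW => ?_⟩
    have := one W hW
    have := Nat.size_le_size (Nat.sub_le (a.eval s) (b.eval s))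
    have := hC s W hs hW
    have := hD s W hs hW
    constructor <;> simp only [Expr.eval, Expr.cost] <;> nlinarith
  | mul a b ha hb =>
    obtain ⟨C, hC⟩ := ha
    obtain ⟨D, hD⟩ := hb
    refine ⟨2 * C + 2 * D + 2, fun s W hs hW => ?_⟩
    have := one W hW
    have := size_mul_le (a.eval s) (b.eval s)
    have := hC s W hs hW
    have := hD s W hs hW
    constructor <;> simp only [Expr.eval, Expr.cost] <;> nlinarith
  | div a b ha hb =>
    obtain ⟨C, hC⟩ := ha
    obtain ⟨D, hD⟩ := hb
    refine ⟨2 * C + 2 * D + 2, fun s W hs hW => ?_⟩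
    have := one W hW
    have := Nat.size_le_size (Nat.div_le_self (a.eval s) (b.eval s))
    have := hC s W hs hW
    have := hD s W hs hW
    constructor <;> simp only [Expr.eval, Expr.cost] <;> nlinarith

/-- A function that bounds the values in the memory after a given number of steps, for programs
that assign only values of expressions with property `ok`. -/
structure IsGrowthBound (ok : Expr → Bool) (G : ℕ → ℕ) : Prop where
  add_one_le : ∀ j, G j + 1 ≤ G (j + 1)
  eval_le : ∀ e, ok e → ∀ (s : Store) (j : ℕ), s.Bounded (G j) → e.eval s ≤ G (j + 1)

theorem IsGrowthBound.monotone {ok : Expr → Bool} {G : ℕ → ℕ} (h : IsGrowthBound ok G) :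
    Monotone G :=
  monotone_nat_of_le_succ fun j => (Nat.le_succ _).trans (h.add_one_le j)

/-- By induction on the program. `G j` bounds the memory once `j` steps have been charged, and `W`
dominates all these bounds, so every operation costs `O(Nat.size W)`. The constant is chosen before
the instance, the growth function and the loop bounds, which makes it uniform over all inputs. -/
theorem LProg.exists_exec (P : LProg) (hwf : P.wf) : ∃ C : ℕ, ∀ (ok : Expr → Bool) (G N : ℕ → ℕ)
    (W j : ℕ) (s : Store), IsGrowthBound ok G → P.allExpr ok → P.FixedBounds →
    (∀ x, P.isBound x → s.reg x ≤ N x) → s.Bounded (G j) → G (j + P.steps N) ≤ W → 1 ≤ W →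
    (P.den s).Bounded (G (j + P.steps N)) ∧
      ∃ T, Exec P.compile s T (P.den s) ∧ T ≤ C * P.steps N * Nat.size W := by
  have one (W : ℕ) (hW : 1 ≤ W) : 1 ≤ Nat.size W := Nat.size_pos.2 hW
  induction P with
  | skip =>
    refine ⟨1, fun ok G N W j s hG _ _ _ hs hle hW => ?_⟩
    exact ⟨hs.mono (hG.monotone (by omega)), 1, Exec.skip s, by
      have := one W hW; simp [LProg.steps]; omega⟩
  | assign r e =>
    obtain ⟨C, hC⟩ := e.exists_cost_le
    refine ⟨1 + C, fun ok G N W j s hG hok _ _ hs hle hW => ?_⟩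
    have hj : G j ≤ G (j + 1) := hG.monotone (by omega)
    refine ⟨(hs.mono hj).setReg r (hG.eval_le e hok s j hs), _, Exec.assign r e s, ?_⟩
    have := (hC s W (hs.mono (hj.trans hle)) hW).2
    have := one W hW
    simp only [LProg.steps]
    nlinarith
  | put A i e =>
    obtain ⟨C, hC⟩ := e.exists_cost_le
    obtain ⟨D, hD⟩ := i.exists_cost_le
    refine ⟨1 + C + D, fun ok G N W j s hG hok _ _ hs hle hW => ?_⟩
    have hj : G j ≤ G (j + 1) := hG.monotone (by omega)
    refine ⟨(hs.mono hj).setArr A _ (hG.eval_le e hok s j hs), _, Exec.put A i e s, ?_⟩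
    have := (hC s W (hs.mono (hj.trans hle)) hW).2
    have := (hD s W (hs.mono (hj.trans hle)) hW).2
    have := one W hW
    simp only [LProg.steps]
    nlinarith
  | seq P Q hP hQ =>
    simp only [LProg.wf, Bool.and_eq_true] at hwf
    obtain ⟨C, hC⟩ := hP hwf.1
    obtain ⟨D, hD⟩ := hQ hwf.2
    refine ⟨C + D, fun ok G N W j s hG hok hfix hN hs hle hW => ?_⟩
    simp only [LProg.allExpr, Bool.and_eq_true] at hok
    simp only [LProg.steps] at hle ⊢
    have hPf : P.FixedBounds := fun x hx => by
      have := hfix x (by simp [LProg.isBound, hx])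
      simp only [LProg.writes, Bool.or_eq_false_iff] at this
      exact this.1
    have hQf : Q.FixedBounds := fun x hx => by
      have := hfix x (by simp [LProg.isBound, hx])
      simp only [LProg.writes, Bool.or_eq_false_iff] at this
      exact this.2
    obtain ⟨hb, T₁, h₁, hT₁⟩ := hC ok G N W j s hG hok.1 hPf
      (fun x hx => hN x (by simp [LProg.isBound, hx])) hs
      ((hG.monotone (by omega)).trans hle) hW
    obtain ⟨hb', T₂, h₂, hT₂⟩ := hD ok G N W (j + P.steps N) (P.den s) hG hok.2 hQf
      (fun x hx => by
        have := hfix x (by simp [LProg.isBound, hx])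
        simp only [LProg.writes, Bool.or_eq_false_iff] at this
        rw [(P.frame_den s).1 x this.1]
        exact hN x (by simp [LProg.isBound, hx])) hb
      (by rwa [add_assoc]) hW
    refine ⟨by rw [← add_assoc]; exact hb', _, Exec.seq h₁ h₂, ?_⟩
    calc T₁ + T₂ ≤ C * P.steps N * W.size + D * Q.steps N * W.size := add_le_add hT₁ hT₂
      _ ≤ _ := by
        rw [← add_mul]
        refine Nat.mul_le_mul_right _ ?_
        nlinarith [Nat.zero_le (C * Q.steps N), Nat.zero_le (D * P.steps N)]
  | branch e P Q hP hQ =>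
    simp only [LProg.wf, Bool.and_eq_true] at hwf
    obtain ⟨C, hC⟩ := hP hwf.1
    obtain ⟨D, hD⟩ := hQ hwf.2
    obtain ⟨E, hE⟩ := e.exists_cost_le
    refine ⟨C + D + E + 1, fun ok G N W j s hG hok hfix hN hs hle hW => ?_⟩
    simp only [LProg.allExpr, Bool.and_eq_true] at hok
    simp only [LProg.steps] at hle ⊢
    have hPf : P.FixedBounds := fun x hx => by
      have := hfix x (by simp [LProg.isBound, hx])
      simp only [LProg.writes, Bool.or_eq_false_iff] at this
      exact this.1
    have hQf : Q.FixedBounds := fun x hx => by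
      have := hfix x (by simp [LProg.isBound, hx])
      simp only [LProg.writes, Bool.or_eq_false_iff] at this
      exact this.2
    have hcost := (hE s W (hs.mono ((hG.monotone (by omega)).trans hle)) hW).2
    have h1 := one W hW
    have tail (K : ℕ) (n T : ℕ) (hK : K ≤ C + D) (hn : n ≤ P.steps N + Q.steps N)
        (hT : T ≤ K * n * W.size) :
        1 + e.cost s + T ≤ (C + D + E + 1) * (1 + P.steps N + Q.steps N) * W.size := by
      have h2 : K * n * W.size ≤ (C + D) * (P.steps N + Q.steps N) * W.size :=
        Nat.mul_le_mul_right _ (Nat.mul_le_mul hK hn)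
      have h3 : 1 + e.cost s + T ≤ (1 + E + (C + D) * (P.steps N + Q.steps N)) * W.size := by
        nlinarith
      refine h3.trans (Nat.mul_le_mul_right _ ?_)
      nlinarith [Nat.zero_le (E * (P.steps N + Q.steps N))]
    by_cases he : e.eval s ≠ 0
    · obtain ⟨hb, T, h, hT⟩ := hC ok G N W j s hG hok.1 hPf
        (fun x hx => hN x (by simp [LProg.isBound, hx])) hs
        ((hG.monotone (by omega)).trans hle) hW
      simp only [LProg.den, if_pos he]
      exact ⟨hb.mono (hG.monotone (by omega)), _, Exec.branch_true he h,
        tail C _ T (by omega) (by omega) hT⟩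
    · obtain ⟨hb, T, h, hT⟩ := hD ok G N W j s hG hok.2 hQf
        (fun x hx => hN x (by simp [LProg.isBound, hx])) hs
        ((hG.monotone (by omega)).trans hle) hW
      simp only [LProg.den, if_neg he]
      exact ⟨hb.mono (hG.monotone (by omega)), _, Exec.branch_false (not_not.1 he) h,
        tail D _ T (by omega) (by omega) hT⟩
  | count r b P hP =>
    simp only [LProg.wf, Bool.and_eq_true, bne_iff_ne, ne_eq, Bool.not_eq_true'] at hwf
    obtain ⟨⟨⟨hrb, hPr⟩, hPb⟩, hPwf⟩ := hwf
    obtain ⟨C, hC⟩ := hP hPwf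
    obtain ⟨E, hE⟩ := (Expr.sub (.reg b) (.reg r)).exists_cost_le
    obtain ⟨D, hD⟩ := (Expr.add (.reg r) (.const 1)).exists_cost_le
    refine ⟨C + D + E + 3, fun ok G N W j s hG hok hfix hN hs hle hW => ?_⟩
    simp only [LProg.allExpr] at hok
    simp only [LProg.steps] at hle ⊢
    have hPf : P.FixedBounds := fun x hx => by
      have := hfix x (by simp [LProg.isBound, hx])
      simp only [LProg.writes, Bool.or_eq_false_iff] at this
      exact this.2
    have h1 := one W hW
    set n := s.reg b with hn
    have hnN : n ≤ N b := hN b (by simp [LProg.isBound])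
    set p := P.steps N with hp
    set h : ℕ → Store := fun i => iterCount P.den r i s with hh
    have hfr (i : ℕ) := LProg.frame_iterCount P.frame_den r b i s
    have hreg (i : ℕ) : (h i).reg r = i := iterCount_reg _ _ _ _
    have hregb (i : ℕ) : (h i).reg b = n := by
      refine (hfr i).1 b ?_
      simp [LProg.writes, hPb, Ne.symm hrb]
    have hNi (i : ℕ) : ∀ x, P.isBound x → (h i).reg x ≤ N x := fun x hx => by
      rw [(hfr i).1 x (hfix x (by simp [LProg.isBound, hx]))]
      exact hN x (by simp [LProg.isBound, hx])
    -- One step is charged for resetting the counter and `p + 2` for each round: `p` for the body,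
    -- and the rest covers the increment with one to spare.
    have hlei (i : ℕ) (hi : i ≤ n) : j + 1 + i * (p + 2) ≤ j + (2 + N b * (p + 2)) := by
      have : i * (p + 2) ≤ N b * (p + 2) := Nat.mul_le_mul_right _ (hi.trans hnN)
      omega
    have hlei' (i : ℕ) (hi : i + 1 ≤ n) : j + 1 + i * (p + 2) + p + 1 ≤ j + (2 + N b * (p + 2)) := by
      have := hlei (i + 1) hi
      rw [add_mul] at this
      omega
    have hbd : ∀ i ≤ n, (h i).Bounded (G (j + 1 + i * (p + 2))) := by
      intro i
      induction i with
      | zero =>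
        intro _
        exact (hs.mono (hG.monotone (by omega))).setReg r (Nat.zero_le _)
      | succ i ih =>
        intro hi
        have hbi := ih (by omega)
        obtain ⟨hb', -⟩ := hC ok G N W _ (h i) hG hok hPf (hNi i) hbi
          ((hG.monotone (by have := hlei' i hi; omega)).trans hle) hW
        -- The old counter value `i` is itself in the memory, so one more step of growth
        -- accommodates `i + 1`; this is the role of `add_one_le`.
        have hval : i + 1 ≤ G (j + 1 + i * (p + 2) + p + 1) := by
          have e1 := hb'.1 r
          have e2 := hG.add_one_le (j + 1 + i * (p + 2) + p)
          rw [(P.frame_den _).1 r hPr, hreg, ← hp] at e1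
          omega
        refine Store.Bounded.mono ((hb'.mono (hG.monotone (Nat.le_succ _))).setReg r hval) ?_
        exact hG.monotone (by rw [add_mul]; omega)
    have hiter (i : ℕ) (hi : i + 1 ≤ n) : ∃ T,
        Exec (.seq P.compile (.assign r (.add (.reg r) (.const 1)))) (h i) T (h (i + 1)) ∧
          T ≤ (C * p + 1 + D) * W.size := by
      obtain ⟨hb', T, hT, hTle⟩ := hC ok G N W _ (h i) hG hok hPf (hNi i) (hbd i (by omega))
        ((hG.monotone (by have := hlei' i hi; omega)).trans hle) hW
      have hval : (Expr.add (.reg r) (.const 1)).eval (P.den (h i)) = i + 1 := by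
        simp only [Expr.eval]
        rw [(P.frame_den _).1 r hPr, hreg]
      have hc := (hD (P.den (h i)) W (hb'.mono
        ((hG.monotone (by have := hlei' i hi; omega)).trans hle)) hW).2
      have hex := Exec.seq hT (Exec.assign r (.add (.reg r) (.const 1)) (P.den (h i)))
      rw [hval] at hex
      refine ⟨_, hex, ?_⟩
      nlinarith
    have hcost (i : ℕ) (hi : i ≤ n) :
        (Expr.sub (.reg b) (.reg r)).cost (h i) ≤ E * W.size :=
      (hE (h i) W ((hbd i hi).mono ((hG.monotone (hlei i hi)).trans hle)) hW).2
    -- Induction on the number `d` of remaining rounds, because `Exec` unfolds a loop from its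
    -- front.
    have hloop : ∀ d ≤ n, ∃ T, Exec (.loop (.sub (.reg b) (.reg r))
        (.seq P.compile (.assign r (.add (.reg r) (.const 1))))) (h (n - d)) T (h n) ∧
        T ≤ ((1 + E) + d * (1 + E + C * p + 1 + D)) * W.size := by
      intro d
      induction d with
      | zero =>
        intro _
        refine ⟨_, Exec.loop_false ?_, ?_⟩
        · simp only [Expr.eval, Nat.sub_zero]
          rw [hreg, hregb]
          omega
        · have := hcost n le_rfl
          simp only [Nat.sub_zero, zero_mul, add_zero]
          nlinarith
      | succ d ih =>
        intro hd
        obtain ⟨T₂, h₂, hT₂⟩ := ih (by omega)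
        obtain ⟨T₁, h₁, hT₁⟩ := hiter (n - (d + 1)) (by omega)
        rw [show n - (d + 1) + 1 = n - d by omega] at h₁
        refine ⟨_, Exec.loop_true ?_ h₁ h₂, ?_⟩
        · simp only [Expr.eval]
          rw [hreg, hregb]
          omega
        · have := hcost (n - (d + 1)) (by omega)
          nlinarith
    obtain ⟨T, hT, hTle⟩ := hloop n le_rfl
    rw [Nat.sub_self] at hT
    refine ⟨(hbd n le_rfl).mono (hG.monotone (hlei n le_rfl)), _,
      Exec.seq (Exec.assign r (.const 0) s) hT, ?_⟩
    have hc0 : (Expr.const 0).cost s = 1 := by simp [Expr.cost]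
    rw [hc0]
    have h2 : 1 + 1 + T ≤ (2 + ((1 + E) + n * (1 + E + C * p + 1 + D))) * W.size := by nlinarith
    refine h2.trans (Nat.mul_le_mul_right _ ?_)
    have h3 : n * (1 + E + C * p + 1 + D) ≤ N b * (1 + E + C * p + 1 + D) :=
      Nat.mul_le_mul_right _ hnN
    have h4 : 1 + E + C * p + 1 + D ≤ (C + D + E + 3) * (p + 2) := by nlinarith
    have h5 := Nat.mul_le_mul_left (N b) h4
    nlinarith

/-- The number of steps is polynomial in the bound of the loops. -/
theorem LProg.exists_steps_eq_eval (P : LProg) : ∃ q : Polynomial ℕ, ∀ (N : ℕ → ℕ) (x : ℕ),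
    (∀ b, P.isBound b → N b = x) → P.steps N = q.eval x := by
  induction P with
  | skip => exact ⟨1, fun N x _ => by simp [LProg.steps]⟩
  | assign r e => exact ⟨1, fun N x _ => by simp [LProg.steps]⟩
  | put A i e => exact ⟨1, fun N x _ => by simp [LProg.steps]⟩
  | seq P Q hP hQ =>
    obtain ⟨p, hp⟩ := hP
    obtain ⟨q, hq⟩ := hQ
    refine ⟨p + q, fun N x h => ?_⟩
    rw [LProg.steps, hp N x fun b hb => h b (by simp [LProg.isBound, hb]),
      hq N x fun b hb => h b (by simp [LProg.isBound, hb]), Polynomial.eval_add]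
  | branch e P Q hP hQ =>
    obtain ⟨p, hp⟩ := hP
    obtain ⟨q, hq⟩ := hQ
    refine ⟨1 + p + q, fun N x h => ?_⟩
    rw [LProg.steps, hp N x fun b hb => h b (by simp [LProg.isBound, hb]),
      hq N x fun b hb => h b (by simp [LProg.isBound, hb])]
    simp
  | count r b P hP =>
    obtain ⟨p, hp⟩ := hP
    refine ⟨2 + Polynomial.X * (p + 2), fun N x h => ?_⟩
    rw [LProg.steps, hp N x fun b hb => h b (by simp [LProg.isBound, hb]),
      h b (by simp [LProg.isBound])]
    simp

/-! ### Growth of the values in the memory -/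

/-- Expressions that do not produce larger values than those in the memory. -/
def Expr.tame : Expr → Bool
  | .const a => decide (a ≤ 1)
  | .reg _ => true
  | .get _ _ => true
  | .add _ _ => false
  | .sub a _ => a.tame
  | .mul _ _ => false
  | .div a _ => a.tame

theorem Expr.eval_le_of_tame {e : Expr} (he : e.tame) {s : Store} {M : ℕ} (hs : s.Bounded M)
    (hM : 1 ≤ M) : e.eval s ≤ M := by
  induction e with
  | const a => simp [Expr.tame] at he; simp [Expr.eval]; omega
  | reg r => exact hs.1 r
  | get A e _ => exact hs.2 A _
  | add a b _ _ => simp [Expr.tame] at he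
  | sub a b ha _ => exact (Nat.sub_le _ _).trans (ha he)
  | mul a b _ _ => simp [Expr.tame] at he
  | div a b ha _ => exact (Nat.div_le_self _ _).trans (ha he)

/-- Expressions that add at most one to the values in the memory. -/
def Expr.slow : Expr → Bool
  | .add a (.const 1) => a.tame
  | e => e.tame

/-- Expressions that at most double the values in the memory. -/
def Expr.doubling : Expr → Bool
  | .add a b => a.tame && b.tame
  | e => e.tame

/-- Used for the search: additive growth over exponentially many steps still gives short numbers. -/
theorem isGrowthBound_add {M : ℕ} (hM : 1 ≤ M) : IsGrowthBound Expr.slow fun j => M + j where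
  add_one_le j := by omega
  eval_le e he s j hs := by
    have hM' : 1 ≤ M + j := by omega
    unfold Expr.slow at he
    split at he
    · have := Expr.eval_le_of_tame he hs hM'
      simp only [Expr.eval]
      omega
    · have := Expr.eval_le_of_tame he hs hM'
      omega

/-- Used for the preparation, where doubling is harmless because the number of steps is polynomial.
-/
theorem isGrowthBound_mul_pow {M : ℕ} (hM : 1 ≤ M) :
    IsGrowthBound Expr.doubling fun j => M * 2 ^ j where
  add_one_le j := by
    have : 1 ≤ M * 2 ^ j := Nat.mul_pos hM (by positivity)
    rw [pow_succ, ← mul_assoc]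
    omega
  eval_le e he s j hs := by
    have hM' : 1 ≤ M * 2 ^ j := Nat.mul_pos hM (by positivity)
    rw [pow_succ, ← mul_assoc]
    unfold Expr.doubling at he
    split at he
    · rw [Bool.and_eq_true] at he
      have := Expr.eval_le_of_tame he.1 hs hM'
      have := Expr.eval_le_of_tame he.2 hs hM'
      simp only [Expr.eval]
      omega
    · have := Expr.eval_le_of_tame he hs hM'
      omega

/-! ### The values of sets of types -/

section Values

variable {V : Type*} {G : SimpleGraph V}

theorem sameType_iff {u v : V} :
    SameType G u v ↔ ∀ w, w ≠ u → w ≠ v → (G.Adj u w ↔ G.Adj v w) := by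
  constructor
  · intro h w hu hv
    have := Set.ext_iff.1 h w
    simpa [hu, hv] using this
  · intro h
    ext w
    simp only [Set.mem_sdiff, SimpleGraph.mem_neighborSet, Set.mem_singleton_iff]
    constructor
    · rintro ⟨hw, hv⟩
      exact ⟨(h w hw.ne' hv).1 hw, hw.ne'⟩
    · rintro ⟨hw, hu⟩
      exact ⟨(h w hu hw.ne').2 hw, hw.ne'⟩

theorem SameType.refl (u : V) : SameType G u u := rfl

theorem SameType.symm {u v : V} (h : SameType G u v) : SameType G v u := Eq.symm h

theorem SameType.adj {u v w : V} (h : SameType G u v) (hw : G.Adj u w) (hne : w ≠ v) :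
    G.Adj v w :=
  (sameType_iff.1 h w hw.ne' hne).1 hw

theorem SameType.trans {u v w : V} (h₁ : SameType G u v) (h₂ : SameType G v w) :
    SameType G u w := by
  have key : ∀ {u v w : V}, SameType G u v → SameType G v w → ∀ x, x ≠ u → x ≠ w →
      G.Adj u x → G.Adj w x := by
    intro u v w h₁ h₂ x hxu hxw h
    -- The middle vertex `v` is the only one that the two hypotheses cannot be chained through;
    -- there the adjacency is transported along the other end, via the edge between `u` and `w`.
    by_cases hxv : x = v
    · subst hxv
      by_cases huw : u = w
      · exact huw ▸ h
      · exact (h₁.adj (h₂.adj h.symm huw).symm (Ne.symm hxw)).symm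
    · exact h₂.adj (h₁.adj h hxv) hxw
  exact sameType_iff.2 fun x hu hw =>
    ⟨key h₁ h₂ x hu hw, key h₂.symm h₁.symm x hw hu⟩

/-- Vertices of the types of two adjacent vertices are adjacent or equal. -/
theorem SameType.adj_of_adj {s s' u u' : V} (hs : SameType G s s') (hu : SameType G u u')
    (h : G.Adj s u) (hne : s' ≠ u') : G.Adj s' u' := by
  by_cases h1 : u = s'
  · subst h1
    by_cases h2 : s = u'
    · exact h2 ▸ h.symm
    · exact (hs.adj (hu.adj h.symm h2).symm hne.symm)
  · exact (hu.adj (hs.adj h h1).symm hne).symm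

/-! ### Scores of components against happy vertices of colorings -/

variable {κ : Type*}

/-- The coloring that gives the color `a` to all uncolored vertices. -/
def fill (c : V → Option κ) (a : κ) (v : V) : κ := (c v).getD a

/-- The vertices in `S` of the component `L` that are happy if all uncolored vertices get the
color `a`. -/
def scoreSet (G : SimpleGraph V) (c : V → Option κ) (S : Set V) (comp : V → ℕ) (L : ℕ) (a : κ) :
    Set V :=
  {v | v ∈ S ∧ comp v = L ∧ IsHappy G (fill c a) v}

theorem mem_scoreSet {c : V → Option κ} {S : Set V} {comp : V → ℕ} {L : ℕ} {a : κ} {v : V} :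
    v ∈ scoreSet G c S comp L a ↔ v ∈ S ∧ comp v = L ∧ IsHappy G (fill c a) v :=
  Iff.rfl

/-- Fill each component with its own color. All neighbors of a vertex of `S` share its label, so its
happiness is decided inside its component. The score sets for different labels are disjoint, so
their sizes add up. -/
theorem exists_coloring_of_score [Finite V] {c : V → Option κ} {S : Set V} {comp : V → ℕ}
    (hcomp : ∀ s ∈ S, ∀ u, G.Adj s u → comp s = comp u) (a : ℕ → κ) (m : ℕ) :
    ∃ c' : V → κ, Extends c' c ∧
      ∑ L ∈ Finset.range m, (scoreSet G c S comp L (a L)).ncard ≤ {v | IsHappy G c' v}.ncard := by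
  classical
  have := Fintype.ofFinite V
  refine ⟨fun v => fill c (a (comp v)) v, fun v i h => by simp [fill, h], ?_⟩
  simp only [Set.ncard_eq_toFinset_card']
  rw [← Finset.card_biUnion]
  · refine Finset.card_le_card fun v hv => ?_
    simp only [Finset.mem_biUnion, Set.mem_toFinset, mem_scoreSet, Set.mem_ofPred_eq] at hv ⊢
    obtain ⟨L, -, hS, rfl, hh⟩ := hv
    intro u hu
    change fill c (a (comp u)) u = _
    rw [← hcomp v hS u hu]
    exact hh u hu
  · intro L _ L' _ hne
    refine Finset.disjoint_left.2 fun v hv hv' => hne ?_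
    simp only [Set.mem_toFinset, mem_scoreSet] at hv hv'
    rw [← hv.2.1, ← hv'.2.1]

/-- The solution need not be constant on components, since `S` may contain unhappy vertices.
Composing it with a retraction `h` onto happy vertices of the same type repairs this and does not
move any happy vertex. -/
theorem exists_score_of_coloring [Finite V] {c : V → Option κ} {S : Set V} {comp : V → ℕ}
    {c' : V → κ} (hc' : Extends c' c) (hS : ∀ v, IsHappy G c' v → v ∈ S)
    (hS' : ∀ v ∈ S, ∃ w, IsHappy G c' w ∧ SameType G v w) [Nonempty κ]
    (hcomp : ∀ f : V → κ, (∀ s ∈ S, ∀ u, G.Adj s u → f s = f u) →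
      ∀ x y, comp x = comp y → f x = f y)
    (m : ℕ) (hm : ∀ v, comp v < m) :
    ∃ a : ℕ → κ, {v | IsHappy G c' v}.ncard ≤
      ∑ L ∈ Finset.range m, (scoreSet G c S comp L (a L)).ncard := by
  classical
  have := Fintype.ofFinite V
  have hex : ∀ v, ∃ w, (v ∈ S → IsHappy G c' w) ∧ SameType G v w ∧
      (IsHappy G c' v ∨ v ∉ S → w = v) := by
    intro v
    by_cases hv : IsHappy G c' v
    · exact ⟨v, fun _ => hv, .refl v, fun _ => rfl⟩
    by_cases hvS : v ∈ S
    · obtain ⟨w, hw, hvw⟩ := hS' v hvS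
      exact ⟨w, fun _ => hw, hvw, fun h => absurd h (by tauto)⟩
    · exact ⟨v, fun h => absurd h hvS, .refl v, fun _ => rfl⟩
  choose h hh ht hf using hex
  -- Replacing both ends by vertices of the same types preserves adjacency unless the ends collapse,
  -- and `h s` is happy.
  have hconst : ∀ s ∈ S, ∀ u, G.Adj s u → c' (h s) = c' (h u) := by
    intro s hs u hu
    by_cases he : h s = h u
    · rw [he]
    · exact (hh s hs _ ((ht s).adj_of_adj (ht u) hu he)).symm
  have hc := hcomp (fun v => c' (h v)) hconst
  -- Every neighbor of a happy `v` has the color `c' v`, so it is either precolored with it or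
  -- uncolored and filled with it.
  have hagree : ∀ v, IsHappy G c' v → IsHappy G (fill c (c' (h v))) v := by
    intro v hv
    rw [hf v (.inl hv)]
    have aux : ∀ w, c' w = c' v → fill c (c' v) w = c' v := by
      intro w hw
      unfold fill
      rcases hcw : c w with _ | i
      · rfl
      · simpa [hw] using (hc' w i hcw).symm
    intro u hu
    rw [aux u (hv u hu), aux v rfl]
  -- By `hc` the choice of a vertex with label `L` is immaterial; labels that do not occur
  -- contribute nothing.
  refine ⟨fun L => if hL : ∃ v, comp v = L then c' (h hL.choose) else Classical.arbitrary κ, ?_⟩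
  simp only [Set.ncard_eq_toFinset_card']
  rw [← Finset.card_biUnion]
  · refine Finset.card_le_card fun v hv => ?_
    simp only [Finset.mem_biUnion, Set.mem_toFinset, mem_scoreSet, Set.mem_ofPred_eq,
      Finset.mem_range] at hv ⊢
    refine ⟨comp v, hm v, hS v hv, rfl, ?_⟩
    have hL : ∃ w, comp w = comp v := ⟨v, rfl⟩
    rw [dif_pos hL]
    have := hc _ _ hL.choose_spec
    rw [this]
    exact hagree v hv
  · intro L _ L' _ hne
    refine Finset.disjoint_left.2 fun v hv hv' => hne ?_
    simp only [Set.mem_toFinset, mem_scoreSet] at hv hv'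
    rw [← hv.2.1, ← hv'.2.1]

/-- Vertices of pairwise distinct types are at most as many as the neighborhood diversity. -/
theorem card_le_neighborhoodDiversity [Fintype V] [DecidableEq V] (R : Finset V)
    (hR : ∀ u ∈ R, ∀ v ∈ R, SameType G u v → u = v) : R.card ≤ neighborhoodDiversity G := by
  -- The partition into singletons shows that the infimum is attained and is not the default value
  -- of an empty set.
  have hne : {t : ℕ | HasTypePartition G t}.Nonempty := by
    refine ⟨_, ⊥, rfl, fun A hA u hu v hv => ?_⟩
    rw [Finpartition.mem_bot_iff] at hA
    obtain ⟨a, -, rfl⟩ := hA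
    rw [Finset.mem_singleton] at hu hv
    rw [hu, hv]
    exact .refl a
  obtain ⟨P, hP, hPt⟩ := Nat.sInf_mem hne
  rw [neighborhoodDiversity, ← hP]
  refine Finset.card_le_card_of_injOn P.part (fun u _ => P.part_mem.2 (Finset.mem_univ u)) ?_
  intro u hu v hv huv
  refine hR u hu v hv (hPt (P.part u) (P.part_mem.2 (Finset.mem_univ u)) u
    (P.mem_part (Finset.mem_univ u)) v ?_)
  rw [huv]
  exact P.mem_part (Finset.mem_univ v)

end Values

/-! ### Counting, and representatives of types -/

section Counting

variable {n : ℕ}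

open Classical in
/-- The number of elements of `T` below `i`. -/
noncomputable def countBelow (T : Set (Fin n)) (i : ℕ) : ℕ :=
  Nat.count (fun j => ∃ h : j < n, (⟨j, h⟩ : Fin n) ∈ T) i

@[simp] theorem countBelow_zero (T : Set (Fin n)) : countBelow T 0 = 0 := by
  simp [countBelow]

theorem countBelow_succ_of_mem {T : Set (Fin n)} {v : Fin n} (h : v ∈ T) :
    countBelow T (v + 1) = countBelow T v + 1 := by
  rw [countBelow, Nat.count_succ, if_pos ⟨v.2, h⟩, countBelow]

theorem countBelow_succ_of_notMem {T : Set (Fin n)} {v : Fin n} (h : v ∉ T) :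
    countBelow T (v + 1) = countBelow T v := by
  rw [countBelow, Nat.count_succ, if_neg (fun ⟨_, h'⟩ => h h'), countBelow, add_zero]

open Classical in
theorem countBelow_injOn {T : Set (Fin n)} {u v : Fin n} (hu : u ∈ T) (hv : v ∈ T)
    (h : countBelow T u = countBelow T v) : u = v :=
  Fin.ext (Nat.count_injective (p := fun j => ∃ h : j < n, (⟨j, h⟩ : Fin n) ∈ T)
    ⟨u.2, hu⟩ ⟨v.2, hv⟩ h)

open Classical in
theorem countBelow_lt {T : Set (Fin n)} {v : Fin n} (hv : v ∈ T) :
    countBelow T v < countBelow T n := by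
  have := Nat.count_monotone (fun j => ∃ h : j < n, (⟨j, h⟩ : Fin n) ∈ T) (Nat.succ_le_of_lt v.2)
  have h2 := countBelow_succ_of_mem hv
  simp only [countBelow, Nat.succ_eq_add_one] at *
  omega

theorem countBelow_eq_ncard (T : Set (Fin n)) : countBelow T n = T.ncard := by
  classical
  rw [countBelow, Nat.count_eq_card_filter_range, Set.ncard_eq_toFinset_card']
  symm
  refine Finset.card_bij (fun v _ => v) (fun v hv => ?_) (fun u _ v _ h => Fin.ext h) fun j hj => ?_
  · simpa using hv
  · simp only [Finset.mem_filter] at hj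
    obtain ⟨-, h, hT⟩ := hj
    exact ⟨⟨j, h⟩, by simpa using hT, rfl⟩

/-! ### Representatives and binary encoding of sets of types -/

open Classical in
/-- The largest vertex of the type of `v`. -/
noncomputable def typeRep (G : SimpleGraph (Fin n)) (v : Fin n) : Fin n :=
  (Finset.univ.filter fun u => SameType G u v).max' ⟨v, by simp [SameType.refl]⟩

variable {G : SimpleGraph (Fin n)}

theorem sameType_typeRep (v : Fin n) : SameType G (typeRep G v) v := by
  classical
  have := Finset.max'_mem (Finset.univ.filter fun u => SameType G u v) ⟨v, by simp [SameType.refl]⟩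
  exact (Finset.mem_filter.1 this).2

theorem le_typeRep {u v : Fin n} (h : SameType G u v) : u ≤ typeRep G v := by
  classical
  exact Finset.le_max' _ _ (by simpa using h)

theorem typeRep_eq_iff {u v : Fin n} : typeRep G u = typeRep G v ↔ SameType G u v := by
  constructor
  · intro h
    exact (sameType_typeRep u).symm.trans (h ▸ sameType_typeRep v)
  · intro h
    exact le_antisymm (le_typeRep ((sameType_typeRep u).trans h))
      (le_typeRep ((sameType_typeRep v).trans h.symm))

/-- The representatives of the types. -/
def typeReps (G : SimpleGraph (Fin n)) : Set (Fin n) := {v | typeRep G v = v}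

theorem typeRep_mem (v : Fin n) : typeRep G v ∈ typeReps G :=
  typeRep_eq_iff.2 (sameType_typeRep v)

/-- Only this inequality is needed: the algorithm never has to know the neighborhood diversity
itself. -/
theorem ncard_typeReps_le : (typeReps G).ncard ≤ neighborhoodDiversity G := by
  classical
  rw [Set.ncard_eq_toFinset_card']
  refine card_le_neighborhoodDiversity _ fun u hu v hv h => ?_
  rw [Set.mem_toFinset] at hu hv
  rw [← show typeRep G u = u from hu, ← show typeRep G v = v from hv]
  exact typeRep_eq_iff.2 h

theorem ncard_typeReps_le_card : (typeReps G).ncard ≤ n := by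
  simpa using Set.ncard_le_card (typeReps G)

/-- The union of the types that the binary digits of `m` encode. -/
def typeUnion (G : SimpleGraph (Fin n)) (m : ℕ) : Set (Fin n) :=
  {v | m / 2 ^ countBelow (typeReps G) (typeRep G v) % 2 ≠ 0}

/-- Binary digits are numbered by the rank of the representative. Ranks are injective on
representatives, so each digit can be prescribed independently. -/
theorem exists_typeUnion (R : Set (Fin n)) :
    ∃ m < 2 ^ (typeReps G).ncard, ∀ v, v ∈ typeUnion G m ↔ typeRep G v ∈ R := by
  classical
  refine ⟨Nat.ofBits fun j : Fin (typeReps G).ncard =>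
    decide (∃ r ∈ typeReps G, countBelow (typeReps G) r = j ∧ r ∈ R), Nat.ofBits_lt_two_pow _,
    fun v => ?_⟩
  have hlt := countBelow_lt (typeRep_mem (G := G) v)
  rw [countBelow_eq_ncard] at hlt
  have hbit (m i : ℕ) : m / 2 ^ i % 2 ≠ 0 ↔ m.testBit i = true := by
    rw [Nat.testBit_eq_decide_div_mod_eq, decide_eq_true_iff]
    omega
  change _ ≠ 0 ↔ _
  rw [hbit, Nat.testBit_ofBits_lt _ _ hlt, decide_eq_true_iff]
  constructor
  · rintro ⟨r, hr, hc, hR⟩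
    exact countBelow_injOn hr (typeRep_mem v) hc ▸ hR
  · exact fun h => ⟨_, typeRep_mem v, rfl, h⟩

end Counting

/-! ### The algorithm -/

/-- An expression that is zero if and only if the two values are equal. -/
def Expr.ne (a b : Expr) : Expr := .add (.sub a b) (.sub b a)

@[simp] theorem Expr.eval_ne_eq_zero {a b : Expr} {s : Store} :
    (a.ne b).eval s = 0 ↔ a.eval s = b.eval s := by
  simp only [Expr.ne, Expr.eval]
  omega

theorem Expr.eval_mul_ne_zero {a b : Expr} {s : Store} :
    (a.mul b).eval s ≠ 0 ↔ a.eval s ≠ 0 ∧ b.eval s ≠ 0 :=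
  mul_ne_zero_iff

/-- The entry of the adjacency matrix for the vertices in the registers `u` and `v`. -/
def adjExpr (u v : ℕ) : Expr := .get 0 (.add (.mul (.reg u) (.reg 0)) (.reg v))

/-- The digit of the type of the vertex in the register `v`. -/
def digitExpr (v : ℕ) : Expr := .get 3 (.get 2 (.reg v))

namespace LProg

/-- Sets register `x` to `1` if `e` is zero for all values of `r` below register `0`, and to `0`
otherwise. -/
def allZero (r x : ℕ) (e : Expr) : LProg :=
  seq (assign x (.const 1)) (count r 0 (branch e (assign x (.const 0)) skip))

/-- Compares the types of the vertices in registers `7` and `8`. -/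
def compareTypes : LProg :=
  allZero 9 10 (.mul (.mul (.ne (.reg 9) (.reg 8)) (.ne (.reg 9) (.reg 7)))
    (.ne (adjExpr 8 9) (adjExpr 7 9)))

/-- Computes in array `2` the representatives of the types of the vertices. -/
def findRep : LProg :=
  seq (put 2 (.reg 7) (.reg 7))
    (count 8 0 (seq compareTypes (branch (.reg 10) (put 2 (.reg 7) (.reg 8)) skip)))

/-- Computes the representatives and, in register `4`, the number of sets of types. -/
def prepare : LProg :=
  seq (assign 4 (.const 1))
    (count 7 0 (seq findRep
      (branch (.ne (.get 2 (.reg 7)) (.reg 7)) skip (assign 4 (.add (.reg 4) (.reg 4))))))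

/-- Writes the binary digits of register `5` to the entries of array `3` at representatives. -/
def decode : LProg :=
  seq (assign 6 (.reg 5))
    (count 7 0 (branch (.ne (.get 2 (.reg 7)) (.reg 7)) skip
      (seq (put 3 (.reg 7) (.sub (.reg 6) (.mul (.const 2) (.div (.reg 6) (.const 2)))))
        (assign 6 (.div (.reg 6) (.const 2))))))

/-- Replaces the label in register `12` by the label in register `11`. -/
def relabel : LProg :=
  count 9 0 (branch (.ne (.get 4 (.reg 9)) (.reg 12)) skip (put 4 (.reg 9) (.reg 11)))

/-- Merges the components of the vertices in the registers `7` and `8` if necessary. -/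
def merge : LProg :=
  branch (.mul (digitExpr 7) (adjExpr 7 8))
    (seq (assign 11 (.get 4 (.reg 7))) (seq (assign 12 (.get 4 (.reg 8))) relabel)) skip

/-- Computes in array `4` labels of components. -/
def components : LProg :=
  seq (count 7 0 (put 4 (.reg 7) (.reg 7))) (count 7 0 (count 8 0 merge))

/-- Computes in array `5` the coloring that gives the color in register `17` to all uncolored
vertices. -/
def fillColor : LProg :=
  count 7 0 (branch (.get 1 (.reg 7)) (put 5 (.reg 7) (.get 1 (.reg 7)))
    (put 5 (.reg 7) (.add (.reg 17) (.const 1))))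

/-- Is the vertex in register `7` happy? -/
def checkHappy : LProg :=
  allZero 8 10 (.mul (adjExpr 7 8) (.ne (.get 5 (.reg 8)) (.get 5 (.reg 7))))

/-- Computes in register `15` the sum of register `13` and the score of component `16`. -/
def countHappy : LProg :=
  seq (assign 15 (.reg 13))
    (count 7 0 (seq checkHappy
      (branch (.mul (.mul (.reg 10) (digitExpr 7))
          (.sub (.const 1) (.ne (.get 4 (.reg 7)) (.reg 16))))
        (assign 15 (.add (.reg 15) (.const 1))) skip)))

/-- Computes in register `14` the sum of register `13` and the best score of component `16`. -/
def bestColor : LProg :=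
  seq (assign 14 (.reg 13))
    (count 17 3 (seq fillColor (seq countHappy
      (branch (.sub (.reg 15) (.reg 14)) (assign 14 (.reg 15)) skip))))

/-- Computes in register `13` the sum of the best scores of all components. -/
def total : LProg :=
  seq (assign 13 (.const 0)) (count 16 0 (seq bestColor (assign 13 (.reg 14))))

/-- Evaluates the set of types that register `5` encodes. -/
def round : LProg :=
  seq decode (seq components (seq total
    (branch (.sub (.reg 1) (.add (.reg 13) (.reg 2))) skip (assign 18 (.const 1)))))

/-- Evaluates all sets of types. -/
def search : LProg := count 5 4 round

end LProg

/-! ### Correctness of the parts of the algorithm -/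

open Classical in
/-- The memory contains the instance, and `k` in register `3`. -/
structure Presents {k : ℕ} (I : MHVInstance k) (s : Store) : Prop where
  reg_zero : s.reg 0 = I.n
  reg_one : s.reg 1 = I.ℓ.toNat
  reg_two : s.reg 2 = (-I.ℓ).toNat
  reg_three : s.reg 3 = k
  adj : ∀ u v : Fin I.n, s.arr 0 (u * I.n + v) = if I.G.Adj u v then 1 else 0
  color : ∀ v : Fin I.n, s.arr 1 v = (I.c v).elim 0 fun a => (a : ℕ) + 1

namespace LProg

/-- The program does not change the part of the memory that contains the instance. -/
def keepsInput (P : LProg) : Bool :=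
  !P.writes 0 && !P.writes 1 && !P.writes 2 && !P.writes 3 && !P.writesArr 0 && !P.writesArr 1

theorem Frame.presents {k : ℕ} {I : MHVInstance k} {s s' : Store} {P : LProg} (h : P.Frame s s')
    (hs : Presents I s) (hP : P.keepsInput = true) : Presents I s' := by
  simp only [keepsInput, Bool.and_eq_true, Bool.not_eq_true'] at hP
  obtain ⟨⟨⟨⟨⟨h0, h1⟩, h2⟩, h3⟩, h4⟩, h5⟩ := hP
  obtain ⟨a0, a1, a2, a3, a4, a5⟩ := hs
  exact ⟨(h.1 0 h0).trans a0, (h.1 1 h1).trans a1, (h.1 2 h2).trans a2, (h.1 3 h3).trans a3,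
    by rwa [h.2 0 h4], by rwa [h.2 1 h5]⟩

theorem den_presents {k : ℕ} {I : MHVInstance k} {s : Store} (P : LProg) (hs : Presents I s)
    (hP : P.keepsInput = true) : Presents I (P.den s) :=
  (P.frame_den s).presents hs hP

/-- Induction along a counting loop that runs over the numbers below `n`. -/
theorem den_count_fin {n r b : ℕ} {P : LProg} {s : Store} (I : ℕ → Store → Prop)
    (hn : s.reg b = n) (zero : I 0 (s.setReg r 0))
    (succ : ∀ (v : Fin n) (s' : Store), s'.reg r = v → (LProg.count r b P).Frame s s' → I v s' →
      I (v + 1) ((P.den s').setReg r (v + 1))) :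
    I n ((LProg.count r b P).den s) := by
  subst hn
  exact den_count_induct I zero fun i hi => succ ⟨i, hi⟩

/-- The flag `x` is cleared at the first bad value and never set again. The test `e` is evaluated in
memories that differ from `s` in the counter and the flag only, hence the form of `hbad`. -/
theorem den_allZero {n r x : ℕ} {e : Expr} {s : Store} (hrx : r ≠ x) (hx : x ≠ 0)
    (hn : s.reg 0 = n) (bad : Fin n → Prop)
    (hbad : ∀ (v : Fin n) (s' : Store), (∀ y, y ≠ r → y ≠ x → s'.reg y = s.reg y) →
      s'.arr = s.arr → s'.reg r = v → (e.eval s' ≠ 0 ↔ bad v)) :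
    ((allZero r x e).den s).reg x ≠ 0 ↔ ∀ v, ¬ bad v := by
  have h0 : (s.setReg x 1).reg 0 = n := by simp [hx.symm, hn]
  have := den_count_fin (r := r) (b := 0) (P := branch e (assign x (.const 0)) skip)
    (s := s.setReg x 1) (fun i s' => s'.reg x ≠ 0 ↔ ∀ v : Fin n, v < i → ¬ bad v) h0
    (by simp [hrx.symm]) ?_
  · refine this.trans ?_
    simp
  intro v s' hr hfr hI
  have hb := hbad v s' (fun y hy hy' => by
      rw [hfr.1 y (by simp [writes, hy, hy'])]
      simp [hy']) (by funext X; exact hfr.2 X rfl) hr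
  have hsucc : (∀ u : Fin n, (u : ℕ) < v + 1 → ¬ bad u) ↔
      (∀ u : Fin n, (u : ℕ) < v → ¬ bad u) ∧ ¬ bad v := by
    constructor
    · exact fun h => ⟨fun u hu => h u (by omega), h v (by omega)⟩
    · rintro ⟨h, hv⟩ u hu
      rcases Nat.lt_succ_iff_lt_or_eq.1 hu with hu | hu
      · exact h u hu
      · exact Fin.ext hu ▸ hv
  simp only [hsucc, ← hI, ← hb, Store.setReg_reg, if_neg hrx.symm, den]
  split_ifs with he
  · simp [Expr.eval, he]
  · simp [he]

variable {k : ℕ} {I : MHVInstance k} {s : Store}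

theorem den_compareTypes (hs : Presents I s) {u v : Fin I.n} (hv : s.reg 7 = v)
    (hu : s.reg 8 = u) :
    (compareTypes.den s).reg 10 ≠ 0 ↔ SameType I.G u v := by
  rw [compareTypes, den_allZero (by decide) (by decide) hs.reg_zero
    (fun w => w ≠ u ∧ w ≠ v ∧ ¬ (I.G.Adj u w ↔ I.G.Adj v w)), sameType_iff]
  · exact forall_congr' fun w => by tauto
  · intro w s' hreg harr hw
    have h7 := hreg 7 (by decide) (by decide)
    have h8 := hreg 8 (by decide) (by decide)
    have h0 := hreg 0 (by decide) (by decide)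
    rw [hv] at h7
    rw [hu] at h8
    rw [hs.reg_zero] at h0
    simp only [Expr.eval, ne_eq, mul_eq_zero, Expr.eval_ne_eq_zero, adjExpr, h7, h8, h0, hw, harr,
      hs.adj, Fin.val_inj, not_or]
    by_cases h1 : I.G.Adj u w <;> by_cases h2 : I.G.Adj v w <;> simp [h1, h2]

/-- The scan goes upwards and overwrites the entry at every match, so the largest vertex of the type
survives; this is why `typeRep` is a maximum. -/
theorem den_findRep (hs : Presents I s) {v : Fin I.n} (hv : s.reg 7 = v) (j : ℕ) :
    (findRep.den s).arr 2 j = if j = v then (typeRep I.G v : ℕ) else s.arr 2 j := by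
  have h0 : ((put 2 (.reg 7) (.reg 7)).den s).reg 0 = I.n := hs.reg_zero
  have := den_count_fin (r := 8) (b := 0)
    (P := seq compareTypes (branch (.reg 10) (put 2 (.reg 7) (.reg 8)) skip))
    (s := (put 2 (.reg 7) (.reg 7)).den s)
    (fun i s' => (∃ u : Fin I.n, SameType I.G u v ∧ s'.arr 2 v = u ∧
      ∀ w : Fin I.n, w < i → SameType I.G w v → w ≤ u) ∧
      ∀ j ≠ (v : ℕ), s'.arr 2 j = s.arr 2 j) h0 ?_ ?_
  · obtain ⟨⟨u, hu, hvu, hmax⟩, hne⟩ := this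
    split_ifs with hj
    · rw [hj, show typeRep I.G v = u from
        le_antisymm (hmax _ (Fin.is_lt _) (sameType_typeRep v)) (le_typeRep hu)]
      exact hvu
    · exact hne j hj
  · refine ⟨⟨v, .refl v, ?_, fun w hw => absurd hw (by omega)⟩, fun j hj => ?_⟩
    · simp [den, Expr.eval, hv]
    · simp [den, Expr.eval, hv, hj]
  · intro u s' hr hfr ⟨⟨x, hx, hvx, hmax⟩, hne⟩
    have hs' : Presents I s' := hfr.presents (den_presents _ hs (by decide)) (by decide)
    have h7 : s'.reg 7 = v := (hfr.1 7 (by decide)).trans hv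
    have hcmp := den_compareTypes hs' h7 hr
    have hfc := compareTypes.frame_den s'
    have c2 := hfc.2 2 (by decide)
    have c7 := hfc.1 7 (by decide)
    have c8 := hfc.1 8 (by decide)
    by_cases hT : SameType I.G u v
    · rw [← hcmp] at hT
      refine ⟨⟨u, hcmp.1 hT, ?_, fun w hw _ => by rw [Fin.le_def]; omega⟩, fun j hj => ?_⟩
      · simp [den, Expr.eval, hT, c7, c8, h7, hr]
      · simp [den, Expr.eval, hT, c7, c8, h7, hr, hj, c2, hne]
    · have hT' := hT
      rw [← hcmp, not_not] at hT'
      refine ⟨⟨x, hx, ?_, fun w hw hwv => ?_⟩, fun j hj => ?_⟩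
      · simp [den, Expr.eval, hT', c2, hvx]
      · rcases Nat.lt_succ_iff_lt_or_eq.1 hw with hw | hw
        · exact hmax w hw hwv
        · exact absurd (Fin.ext hw ▸ hwv) hT
      · simp [den, Expr.eval, hT', c2, hne j hj]

theorem den_prepare (hs : Presents I s) :
    (prepare.den s).reg 4 = 2 ^ (typeReps I.G).ncard ∧
      ∀ v : Fin I.n, (prepare.den s).arr 2 v = typeRep I.G v := by
  have h0 : (s.setReg 4 1).reg 0 = I.n := by simpa using hs.reg_zero
  have := den_count_fin (r := 7) (b := 0) (P := seq findRep
      (branch (.ne (.get 2 (.reg 7)) (.reg 7)) skip (assign 4 (.add (.reg 4) (.reg 4)))))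
    (s := s.setReg 4 1)
    (fun i s' => s'.reg 4 = 2 ^ countBelow (typeReps I.G) i ∧
      ∀ v : Fin I.n, v < i → s'.arr 2 v = typeRep I.G v) h0 (by simp) ?_
  · rw [countBelow_eq_ncard] at this
    exact ⟨this.1, fun v => this.2 v v.2⟩
  · intro v s' hr hfr ⟨h4, hlt⟩
    have hs' : Presents I s' :=
      hfr.presents (den_presents (assign 4 (.const 1)) hs (by decide)) (by decide)
    have hfind := den_findRep hs' hr
    have hff := findRep.frame_den s'
    have f4 := hff.1 4 (by decide)
    have f7 := hff.1 7 (by decide)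
    have harr : ∀ u : Fin I.n, (u : ℕ) < v + 1 → (findRep.den s').arr 2 u = typeRep I.G u := by
      intro u hu
      rw [hfind]
      rcases Nat.lt_succ_iff_lt_or_eq.1 hu with hu | hu
      · rw [if_neg hu.ne, hlt u hu]
      · rw [if_pos hu, Fin.ext hu]
    have hvv := harr v (by omega)
    by_cases hv : v ∈ typeReps I.G
    · have hv' : typeRep I.G v = v := hv
      rw [hv'] at hvv
      rw [countBelow_succ_of_mem hv]
      have hz : ((Expr.get 2 (.reg 7)).ne (.reg 7)).eval (findRep.den s') = 0 := by
        simp [Expr.eval, f7, hr, hvv]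
      refine ⟨?_, fun u hu => ?_⟩
      · simp only [den, hz, ne_eq, not_true_eq_false, if_false, Store.setReg_reg, Expr.eval, f4, h4]
        simp
        ring
      · simpa [den, hz] using harr u hu
    · have hv' : typeRep I.G v ≠ v := hv
      rw [countBelow_succ_of_notMem hv]
      have hz : ((Expr.get 2 (.reg 7)).ne (.reg 7)).eval (findRep.den s') ≠ 0 := by
        simp [Expr.eval, f7, hr, hvv, hv', Fin.val_inj]
      refine ⟨?_, fun u hu => ?_⟩
      · simp [den, hz, f4, h4]
      · simpa [den, hz] using harr u hu

/-- Register `6` is halved exactly at the representatives, so its parity at a representative is the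
digit whose index is the rank. Other vertices read the digit of their representative. -/
theorem den_decode (hs : Presents I s) (hrep : ∀ v : Fin I.n, s.arr 2 v = typeRep I.G v)
    (v : Fin I.n) :
    (decode.den s).arr 3 ((decode.den s).arr 2 v) ≠ 0 ↔ v ∈ typeUnion I.G (s.reg 5) := by
  have h0 : (s.setReg 6 (s.reg 5)).reg 0 = I.n := by simpa using hs.reg_zero
  have := den_count_fin (r := 7) (b := 0) (P := branch (.ne (.get 2 (.reg 7)) (.reg 7)) skip
      (seq (put 3 (.reg 7) (.sub (.reg 6) (.mul (.const 2) (.div (.reg 6) (.const 2)))))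
        (assign 6 (.div (.reg 6) (.const 2)))))
    (s := s.setReg 6 (s.reg 5))
    (fun i s' => s'.reg 6 = s.reg 5 / 2 ^ countBelow (typeReps I.G) i ∧
      ∀ v ∈ typeReps I.G, v < i →
        s'.arr 3 v = s.reg 5 / 2 ^ countBelow (typeReps I.G) v % 2) h0 (by simp) ?_
  · rw [(decode.frame_den s).2 2 (by decide), hrep]
    have h := this.2 (typeRep I.G v) (typeRep_mem v) (Fin.is_lt _)
    exact (not_congr (Eq.congr_left h))
  · intro u s' hr hfr ⟨h6, hlt⟩
    have h2 : s'.arr 2 u = typeRep I.G u := by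
      rw [hfr.2 2 (by decide), Store.setReg_arr, hrep]
    by_cases hu : u ∈ typeReps I.G
    · have hu' : typeRep I.G u = u := hu
      rw [hu'] at h2
      rw [countBelow_succ_of_mem hu]
      have hz : ((Expr.get 2 (.reg 7)).ne (.reg 7)).eval s' = 0 := by
        simp [Expr.eval, hr, h2]
      refine ⟨?_, fun w hw hwu => ?_⟩
      · simp [den, hz, Expr.eval, h6, Nat.div_div_eq_div_mul, pow_succ]
      · simp only [den, hz, ne_eq, not_true_eq_false, if_false, Store.setReg_arr, Expr.eval, hr,
          Store.setArr_arr_same]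
        split_ifs with hwu'
        · rw [h6, ← hwu']
          omega
        · exact hlt w hw (by omega)
    · have hu' : typeRep I.G u ≠ u := hu
      rw [countBelow_succ_of_notMem hu]
      have hz : ((Expr.get 2 (.reg 7)).ne (.reg 7)).eval s' ≠ 0 := by
        simp [Expr.eval, hr, h2, hu', Fin.val_inj]
      refine ⟨by simp [den, hz, h6], fun w hw hwu => ?_⟩
      have : (w : ℕ) ≠ u := fun h => hu (Fin.ext h ▸ hw)
      simpa [den, hz] using hlt w hw (by omega)

end LProg

/-! ### Labels of components -/

/-- The labels `l` are labels of components, as far as the edges between `s` and `u` with `D s u`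
and `s ∈ S` are concerned. -/
structure IsLabeling {n : ℕ} (G : SimpleGraph (Fin n)) (S : Set (Fin n))
    (D : Fin n → Fin n → Prop) (κ : Type*) (l : ℕ → ℕ) : Prop where
  lt : ∀ v : Fin n, l v < n
  eq_of_adj : ∀ s ∈ S, ∀ u, G.Adj s u → D s u → l s = l u
  eq_of_eq : ∀ f : Fin n → κ, (∀ s ∈ S, ∀ u, G.Adj s u → f s = f u) →
    ∀ x y : Fin n, l x = l y → f x = f y

namespace LProg

variable {k : ℕ} {I : MHVInstance k} {s : Store}

theorem den_relabel (hs : Presents I s) (v : Fin I.n) :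
    (relabel.den s).arr 4 v = if s.arr 4 v = s.reg 12 then s.reg 11 else s.arr 4 v := by
  have := den_count_fin (r := 9) (b := 0)
    (P := branch (.ne (.get 4 (.reg 9)) (.reg 12)) skip (put 4 (.reg 9) (.reg 11))) (s := s)
    (fun i s' => ∀ v : Fin I.n, s'.arr 4 v =
      if (v : ℕ) < i ∧ s.arr 4 v = s.reg 12 then s.reg 11 else s.arr 4 v) hs.reg_zero (by simp) ?_
  · have h := this v
    simp only [Fin.is_lt, true_and] at h
    exact h
  · intro u s' hr hfr hI w
    have h11 := hfr.1 11 (by decide)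
    have h12 := hfr.1 12 (by decide)
    have hu := hI u
    simp only [lt_irrefl, false_and, if_false] at hu
    have hw := hI w
    simp only [den, Store.setReg_arr, ne_eq, Expr.eval_ne_eq_zero, Expr.eval, hr, hu, h12]
    by_cases hwu : w = u
    · subst hwu
      by_cases he : s.arr 4 w = s.reg 12 <;> simp [he, h11, hw]
    · have hwu' : (w : ℕ) ≠ u := fun h => hwu (Fin.ext h)
      have hlt : (w : ℕ) < u + 1 ↔ (w : ℕ) < u := by omega
      by_cases he : s.arr 4 u = s.reg 12 <;> simp [he, hw, hwu', hlt]

/-- `D` records the pairs already processed. Identifying two labels is sound because every `f` that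
is constant along edges at `S` satisfies `f x = f y`; a pair that is not such an edge imposes no
condition. -/
theorem den_merge {S : Set (Fin I.n)} {D : Fin I.n → Fin I.n → Prop} {κ : Type*}
    (hs : Presents I s) (hS : ∀ v : Fin I.n, s.arr 3 (s.arr 2 v) ≠ 0 ↔ v ∈ S) {x y : Fin I.n}
    (hx : s.reg 7 = x) (hy : s.reg 8 = y) (hl : IsLabeling I.G S D κ (s.arr 4)) :
    IsLabeling I.G S (fun a b => D a b ∨ (a = x ∧ b = y)) κ ((merge.den s).arr 4) := by
  have hcond : (Expr.mul (digitExpr 7) (adjExpr 7 8)).eval s ≠ 0 ↔ x ∈ S ∧ I.G.Adj x y := by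
    simp only [digitExpr, adjExpr, Expr.eval, hx, hy, hs.reg_zero, hs.adj, mul_ne_zero_iff, hS]
    simp
  by_cases hc : x ∈ S ∧ I.G.Adj x y
  · have hval (v : Fin I.n) : (merge.den s).arr 4 v =
        if s.arr 4 v = s.arr 4 y then s.arr 4 x else s.arr 4 v := by
      have h := den_relabel (den_presents (assign 12 (.get 4 (.reg 8)))
        (den_presents (assign 11 (.get 4 (.reg 7))) hs rfl) rfl) v
      rw [merge, den, if_pos (hcond.2 hc)]
      refine h.trans ?_
      simp [den, Expr.eval, hx, hy]
    refine ⟨fun v => ?_, fun a ha b hab hD => ?_, fun f hf a b hab => ?_⟩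
    · rw [hval]
      split_ifs
      exacts [hl.lt x, hl.lt v]
    · rw [hval, hval]
      rcases hD with hD | ⟨rfl, rfl⟩
      · rw [hl.eq_of_adj a ha b hab hD]
      · simp
    · rw [hval, hval] at hab
      have hxy : f x = f y := hf x hc.1 y hc.2
      split_ifs at hab with h1 h2 h2
      · rw [hl.eq_of_eq f hf a y h1, hl.eq_of_eq f hf b y h2]
      · rw [hl.eq_of_eq f hf a y h1, ← hxy, hl.eq_of_eq f hf x b hab]
      · rw [hl.eq_of_eq f hf b y h2, ← hxy, hl.eq_of_eq f hf a x hab]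
      · exact hl.eq_of_eq f hf a b hab
  · have hval : (merge.den s).arr 4 = s.arr 4 := by
      rw [merge, den, if_neg (mt hcond.1 hc), den]
    rw [hval]
    refine ⟨hl.lt, fun a ha b hab hD => ?_, hl.eq_of_eq⟩
    rcases hD with hD | ⟨rfl, rfl⟩
    · exact hl.eq_of_adj a ha b hab hD
    · exact absurd ⟨ha, hab⟩ hc

/-- Distinct initial labels make `eq_of_eq` trivial, and each merge preserves it. This field says
that the labels are not too coarse, in exactly the form that `exists_score_of_coloring` consumes, so
no notion of connectedness is needed. -/
theorem den_components {S : Set (Fin I.n)} (κ : Type*) (hs : Presents I s)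
    (hS : ∀ v : Fin I.n, s.arr 3 (s.arr 2 v) ≠ 0 ↔ v ∈ S) :
    IsLabeling I.G S (fun _ _ => True) κ ((components.den s).arr 4) := by
  rw [components, den]
  set s₀ := (count 7 0 (put 4 (.reg 7) (.reg 7))).den s with hs₀
  have hf₀ : Frame _ s s₀ := frame_den _ _
  have hp₀ : Presents I s₀ := hf₀.presents hs rfl
  have hinit : ∀ v : Fin I.n, s₀.arr 4 v = v := by
    have := den_count_fin (r := 7) (b := 0) (P := put 4 (.reg 7) (.reg 7)) (s := s)
      (fun i s' => ∀ v : Fin I.n, v < i → s'.arr 4 v = v) hs.reg_zero (by simp) ?_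
    · exact fun v => this v v.2
    · intro u s' hr hfr hI v hv
      simp only [den, Expr.eval, hr, Store.setReg_arr, Store.setArr_arr_same]
      split_ifs with h
      · exact h.symm
      · exact hI v (by omega)
  have hl₀ : IsLabeling I.G S (fun _ _ => False) κ (s₀.arr 4) := by
    refine ⟨fun v => by rw [hinit]; exact v.2, fun _ _ _ _ h => h.elim, fun f _ x y h => ?_⟩
    rw [hinit, hinit] at h
    rw [Fin.ext h]
  have := den_count_fin (r := 7) (b := 0) (P := count 8 0 merge) (s := s₀)
    (fun i s' => IsLabeling I.G S (fun a _ => (a : ℕ) < i) κ (s'.arr 4)) hp₀.reg_zero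
    (by simpa using hl₀) ?_
  · simpa using this
  intro x s' hr hfr hI
  have hp' : Presents I s' := hfr.presents hp₀ rfl
  have hinner := den_count_fin (r := 8) (b := 0) (P := merge) (s := s')
    (fun j s'' => IsLabeling I.G S (fun a b => (a : ℕ) < x ∨ (a = x ∧ (b : ℕ) < j)) κ (s''.arr 4))
    hp'.reg_zero (by simpa using hI) ?_
  · simp only [Fin.is_lt, and_true] at hinner
    have he : (fun a _ : Fin I.n => (a : ℕ) < x + 1) =
        fun a _ : Fin I.n => (a : ℕ) < x ∨ a = x := by
      funext a _
      rw [Nat.lt_succ_iff_lt_or_eq, Fin.val_inj]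
    rw [he]
    exact hinner
  · intro y s'' hr' hfr' hJ
    have hp'' : Presents I s'' := hfr'.presents hp' rfl
    have h7 : s''.reg 7 = x := (hfr'.1 7 rfl).trans hr
    have hS'' : ∀ v : Fin I.n, s''.arr 3 (s''.arr 2 v) ≠ 0 ↔ v ∈ S := fun v => by
      rw [hfr'.2 3 rfl, hfr'.2 2 rfl, hfr.2 3 rfl, hfr.2 2 rfl, hf₀.2 3 rfl, hf₀.2 2 rfl, hS]
    have hm := den_merge hp'' hS'' h7 hr' hJ
    have he : (fun a b : Fin I.n => (a : ℕ) < x ∨ (a = x ∧ (b : ℕ) < y + 1)) =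
        fun a b : Fin I.n => ((a : ℕ) < x ∨ (a = x ∧ (b : ℕ) < y)) ∨ (a = x ∧ b = y) := by
      funext a b
      rw [Nat.lt_succ_iff_lt_or_eq, Fin.val_inj, and_or_left, or_assoc]
    rw [he]
    exact hm

/-! ### Scores computed by the program -/

theorem den_fillColor (hs : Presents I s) {a : Fin k} (ha : s.reg 17 = a) (v : Fin I.n) :
    (fillColor.den s).arr 5 v = ((fill I.c a v : Fin k) : ℕ) + 1 := by
  have := den_count_fin (r := 7) (b := 0)
    (P := branch (.get 1 (.reg 7)) (put 5 (.reg 7) (.get 1 (.reg 7)))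
      (put 5 (.reg 7) (.add (.reg 17) (.const 1)))) (s := s)
    (fun i s' => ∀ v : Fin I.n, v < i → s'.arr 5 v = ((fill I.c a v : Fin k) : ℕ) + 1)
    hs.reg_zero (by simp) ?_
  · exact this v v.2
  · intro u s' hr hfr hI w hw
    have hp' : Presents I s' := hfr.presents hs rfl
    have h17 : s'.reg 17 = a := (hfr.1 17 rfl).trans ha
    have hcol := hp'.color u
    have hval : (((branch (.get 1 (.reg 7)) (put 5 (.reg 7) (.get 1 (.reg 7)))
      (put 5 (.reg 7) (.add (.reg 17) (.const 1)))).den s').setReg 7 (u + 1)).arr 5 w =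
        if (w : ℕ) = u then ((fill I.c a u : Fin k) : ℕ) + 1 else s'.arr 5 w := by
      simp only [den, Expr.eval, hr, hcol, h17, fill, Store.setReg_arr]
      rcases I.c u with _ | i <;> simp
    rw [hval]
    split_ifs with hwu
    · rw [Fin.ext hwu]
    · exact hI w (by omega)

theorem den_checkHappy (hs : Presents I s) {a : Fin k}
    (hcol : ∀ v : Fin I.n, s.arr 5 v = ((fill I.c a v : Fin k) : ℕ) + 1) {v : Fin I.n}
    (hv : s.reg 7 = v) :
    (checkHappy.den s).reg 10 ≠ 0 ↔ IsHappy I.G (fill I.c a) v := by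
  rw [checkHappy, den_allZero (by decide) (by decide) hs.reg_zero
    (fun u => I.G.Adj v u ∧ fill I.c a u ≠ fill I.c a v)]
  · simp [IsHappy]
  · intro u s' hreg harr hu
    have h7 := hreg 7 (by decide) (by decide)
    have h0 := hreg 0 (by decide) (by decide)
    rw [hv] at h7
    rw [hs.reg_zero] at h0
    simp only [Expr.eval, ne_eq, mul_eq_zero, Expr.eval_ne_eq_zero, adjExpr, h7, h0, hu, harr,
      hs.adj, hcol, not_or, Nat.add_right_cancel_iff, Fin.val_inj]
    simp

/-- The counter starts at the running total in register `13` rather than at zero. Thus the search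
never adds two registers in an assignment, as `Expr.slow` requires. -/
theorem den_countHappy {S : Set (Fin I.n)} (hs : Presents I s)
    (hS : ∀ v : Fin I.n, s.arr 3 (s.arr 2 v) ≠ 0 ↔ v ∈ S) {a : Fin k}
    (hcol : ∀ v : Fin I.n, s.arr 5 v = ((fill I.c a v : Fin k) : ℕ) + 1) :
    (countHappy.den s).reg 15 =
      s.reg 13 + (scoreSet I.G I.c S (fun v => s.arr 4 v) (s.reg 16) a).ncard := by
  set T := scoreSet I.G I.c S (fun v => s.arr 4 v) (s.reg 16) a with hT
  have h0 : (s.setReg 15 (s.reg 13)).reg 0 = I.n := by simpa using hs.reg_zero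
  have := den_count_fin (r := 7) (b := 0) (P := seq checkHappy
      (branch (.mul (.mul (.reg 10) (digitExpr 7))
          (.sub (.const 1) (.ne (.get 4 (.reg 7)) (.reg 16))))
        (assign 15 (.add (.reg 15) (.const 1))) skip)) (s := s.setReg 15 (s.reg 13))
    (fun i s' => s'.reg 15 = s.reg 13 + countBelow T i) h0 (by simp) ?_
  · rw [countBelow_eq_ncard] at this
    exact this
  · intro v s' hr hfr hI
    have hp' : Presents I s' :=
      hfr.presents (den_presents (assign 15 (.reg 13)) hs rfl) rfl
    have hcol' : ∀ v : Fin I.n, s'.arr 5 v = ((fill I.c a v : Fin k) : ℕ) + 1 := fun v => by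
      rw [hfr.2 5 rfl]; exact hcol v
    have hh := den_checkHappy hp' hcol' hr
    have hfc := checkHappy.frame_den s'
    have h15 : (checkHappy.den s').reg 15 = s.reg 13 + countBelow T v := (hfc.1 15 rfl).trans hI
    have h7 : (checkHappy.den s').reg 7 = v := (hfc.1 7 rfl).trans hr
    have h16 : (checkHappy.den s').reg 16 = s.reg 16 := by
      rw [hfc.1 16 rfl, hfr.1 16 rfl]; simp
    have hX (X : ℕ) (h : (X == 2 || X == 3 || X == 4) = true) :
        (checkHappy.den s').arr X = s.arr X := by
      simp only [Bool.or_eq_true, beq_iff_eq] at h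
      rcases h with (rfl | rfl) | rfl
      · rw [hfc.2 2 rfl, hfr.2 2 rfl]; rfl
      · rw [hfc.2 3 rfl, hfr.2 3 rfl]; rfl
      · rw [hfc.2 4 rfl, hfr.2 4 rfl]; rfl
    have hcond : (Expr.mul (.mul (.reg 10) (digitExpr 7))
          (.sub (.const 1) (.ne (.get 4 (.reg 7)) (.reg 16)))).eval (checkHappy.den s') ≠ 0 ↔
        v ∈ T := by
      have hne : ((Expr.const 1).sub (.ne (.get 4 (.reg 7)) (.reg 16))).eval
          (checkHappy.den s') ≠ 0 ↔ s.arr 4 v = s.reg 16 := by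
        have := Expr.eval_ne_eq_zero (a := .get 4 (.reg 7)) (b := .reg 16) (s := checkHappy.den s')
        simp only [Expr.eval, h7, h16, hX 4 rfl] at this ⊢
        omega
      have hd : (digitExpr 7).eval (checkHappy.den s') ≠ 0 ↔ v ∈ S := by
        simp only [digitExpr, Expr.eval, h7, hX 2 rfl, hX 3 rfl, hS]
      rw [Expr.eval_mul_ne_zero, Expr.eval_mul_ne_zero, hne, hd, Expr.eval, hh, hT, mem_scoreSet]
      tauto
    rw [Store.setReg_reg, if_neg (by decide), den, den]
    by_cases hv : v ∈ T
    · rw [if_pos (hcond.2 hv), countBelow_succ_of_mem hv]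
      simp [den, Expr.eval, h15, add_assoc]
    · rw [if_neg (mt hcond.1 hv), countBelow_succ_of_notMem hv, den, h15]

theorem den_bestColor {S : Set (Fin I.n)} (hs : Presents I s)
    (hS : ∀ v : Fin I.n, s.arr 3 (s.arr 2 v) ≠ 0 ↔ v ∈ S) [Nonempty (Fin k)] :
    let score := fun a => (scoreSet I.G I.c S (fun v => s.arr 4 v) (s.reg 16) a).ncard
    (∃ a : Fin k, (bestColor.den s).reg 14 ≤ s.reg 13 + score a) ∧
      ∀ a : Fin k, s.reg 13 + score a ≤ (bestColor.den s).reg 14 := by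
  intro score
  have h3 : (s.setReg 14 (s.reg 13)).reg 3 = k := by simpa using hs.reg_three
  have := den_count_fin (r := 17) (b := 3) (P := seq fillColor (seq countHappy
      (branch (.sub (.reg 15) (.reg 14)) (assign 14 (.reg 15)) skip)))
    (s := s.setReg 14 (s.reg 13))
    (fun i s' => (∃ a : Fin k, s'.reg 14 ≤ s.reg 13 + score a) ∧
      ∀ a : Fin k, a < i → s.reg 13 + score a ≤ s'.reg 14) h3
    -- Before the first round the running maximum is the bare total, which is below the value of any
    -- color; some color must exist for this.
    ⟨⟨Classical.arbitrary _, by simp⟩, by simp⟩ ?_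
  · exact ⟨this.1, fun a => this.2 a a.2⟩
  · intro a s' hr hfr ⟨hex, hall⟩
    have hp' : Presents I s' :=
      hfr.presents (den_presents (assign 14 (.reg 13)) hs rfl) rfl
    have hf1 := fillColor.frame_den s'
    have hp1 := hf1.presents hp' rfl
    have hX (X : ℕ) (h : (X == 2 || X == 3 || X == 4) = true) :
        (fillColor.den s').arr X = s.arr X := by
      simp only [Bool.or_eq_true, beq_iff_eq] at h
      rcases h with (rfl | rfl) | rfl
      · rw [hf1.2 2 rfl, hfr.2 2 rfl]; rfl
      · rw [hf1.2 3 rfl, hfr.2 3 rfl]; rfl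
      · rw [hf1.2 4 rfl, hfr.2 4 rfl]; rfl
    have hc := den_countHappy (S := S) hp1 (fun v => by rw [hX 2 rfl, hX 3 rfl, hS])
      (den_fillColor hp' hr)
    have hf2 := countHappy.frame_den (fillColor.den s')
    have h13 : (fillColor.den s').reg 13 = s.reg 13 := by
      rw [hf1.1 13 rfl, hfr.1 13 rfl]; simp
    have h16 : (fillColor.den s').reg 16 = s.reg 16 := by
      rw [hf1.1 16 rfl, hfr.1 16 rfl]; simp
    rw [hX 4 rfl, h13, h16] at hc
    have h14 : (countHappy.den (fillColor.den s')).reg 14 = s'.reg 14 := by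
      rw [hf2.1 14 rfl, hf1.1 14 rfl]
    have hval : (((seq fillColor (seq countHappy
      (branch (.sub (.reg 15) (.reg 14)) (assign 14 (.reg 15)) skip))).den s').setReg 17
        (a + 1)).reg 14 = max (s'.reg 14) (s.reg 13 + score a) := by
      have hc' : (countHappy.den (fillColor.den s')).reg 15 = s.reg 13 + score a := hc
      rw [Store.setReg_reg, if_neg (by decide)]
      simp only [den, Expr.eval, hc', h14]
      split_ifs with h
      · simp only [Store.setReg_reg, if_true]
        exact (max_eq_right (by omega)).symm
      · rw [h14]
        exact (max_eq_left (by omega)).symm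
    rw [hval]
    refine ⟨?_, fun b hb => ?_⟩
    · rcases max_choice (s'.reg 14) (s.reg 13 + score a) with h | h
      · rw [h]; exact hex
      · rw [h]; exact ⟨a, le_rfl⟩
    · rcases Nat.lt_succ_iff_lt_or_eq.1 hb with hb | hb
      · exact (hall b hb).trans (le_max_left _ _)
      · rw [Fin.ext hb]
        exact le_max_right _ _

/-- The two halves say that the total is the maximum over all assignments of colors to labels. It
may be built greedily because the score of a label depends on its own color only; labels are below
`n`, so `n` rounds suffice. -/
theorem den_total {S : Set (Fin I.n)} (hs : Presents I s)
    (hS : ∀ v : Fin I.n, s.arr 3 (s.arr 2 v) ≠ 0 ↔ v ∈ S) [Nonempty (Fin k)] :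
    let score := fun L a => (scoreSet I.G I.c S (fun v => s.arr 4 v) L a).ncard
    (∃ a : ℕ → Fin k, (total.den s).reg 13 ≤ ∑ L ∈ Finset.range I.n, score L (a L)) ∧
      ∀ a : ℕ → Fin k, ∑ L ∈ Finset.range I.n, score L (a L) ≤ (total.den s).reg 13 := by
  intro score
  have h0 : (s.setReg 13 0).reg 0 = I.n := by simpa using hs.reg_zero
  have := den_count_fin (r := 16) (b := 0) (P := seq bestColor (assign 13 (.reg 14)))
    (s := s.setReg 13 0)
    (fun i s' =>
      (∃ a : ℕ → Fin k, s'.reg 13 ≤ ∑ L ∈ Finset.range i, score L (a L)) ∧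
        ∀ a : ℕ → Fin k, ∑ L ∈ Finset.range i, score L (a L) ≤ s'.reg 13) h0
    ⟨⟨Classical.arbitrary _, by simp⟩, by simp⟩ ?_
  · exact this
  · intro L s' hr hfr ⟨⟨b, hb⟩, hall⟩
    have hp' : Presents I s' := hfr.presents (den_presents (assign 13 (.const 0)) hs rfl) rfl
    have hX (X : ℕ) (h : (X == 2 || X == 3 || X == 4) = true) : s'.arr X = s.arr X := by
      simp only [Bool.or_eq_true, beq_iff_eq] at h
      rcases h with (rfl | rfl) | rfl
      · rw [hfr.2 2 rfl]; rfl
      · rw [hfr.2 3 rfl]; rfl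
      · rw [hfr.2 4 rfl]; rfl
    obtain ⟨⟨a, ha⟩, hle⟩ := den_bestColor (S := S) hp' fun v => by rw [hX 2 rfl, hX 3 rfl, hS]
    rw [hX 4 rfl, hr] at ha
    simp only [hX 4 rfl, hr] at hle
    have hval : (((seq bestColor (assign 13 (.reg 14))).den s').setReg 16 (L + 1)).reg 13 =
        (bestColor.den s').reg 14 := by
      simp [den, Expr.eval]
    rw [hval]
    refine ⟨⟨Function.update b L a, ?_⟩, fun c => ?_⟩
    · rw [Finset.sum_range_succ, Function.update_self]
      refine ha.trans (Nat.add_le_add_right (hb.trans_eq ?_) _)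
      refine Finset.sum_congr rfl fun j hj => ?_
      rw [Function.update_of_ne (Finset.mem_range.1 hj).ne]
    · rw [Finset.sum_range_succ]
      exact (Nat.add_le_add_right (hall c) _).trans (hle (c L))

end LProg

/-! ### Correctness and running time of the algorithm -/

/-- The set of types that `m` encodes is the set of the types of happy vertices of a solution. -/
def IsWitness {k : ℕ} (I : MHVInstance k) (m : ℕ) : Prop :=
  ∃ c' : Fin I.n → Fin k, Extends c' I.c ∧
    I.ℓ ≤ (({v | IsHappy I.G c' v} : Set (Fin I.n)).ncard : ℤ) ∧
    (∀ v, IsHappy I.G c' v → v ∈ typeUnion I.G m) ∧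
    ∀ v ∈ typeUnion I.G m, ∃ w, IsHappy I.G c' w ∧ SameType I.G v w

theorem MHVInstance.IsYes.exists_isWitness {k : ℕ} {I : MHVInstance k} (h : I.IsYes) :
    ∃ m < 2 ^ (typeReps I.G).ncard, IsWitness I m := by
  obtain ⟨c', hc, hl⟩ := h
  obtain ⟨m, hm, hmem⟩ := exists_typeUnion (G := I.G)
    {v | ∃ w, IsHappy I.G c' w ∧ SameType I.G v w}
  refine ⟨m, hm, c', hc, hl, fun v hv => ?_, fun v hv => ?_⟩
  · exact (hmem v).2 ⟨v, hv, sameType_typeRep v⟩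
  · obtain ⟨w, hw, hvw⟩ := (hmem v).1 hv
    exact ⟨w, hw, (sameType_typeRep v).symm.trans hvw⟩

namespace LProg

variable {k : ℕ} {I : MHVInstance k} {s : Store}

/-- Any guess, right or wrong, yields a genuine coloring, so the flag is never raised unjustly. Only
a guess that matches a solution is required to raise it. -/
theorem den_round (hs : Presents I s) (hrep : ∀ v : Fin I.n, s.arr 2 v = typeRep I.G v)
    [Nonempty (Fin k)] :
    ((round.den s).reg 18 = s.reg 18 ∨ (round.den s).reg 18 = 1 ∧ I.IsYes) ∧
      (IsWitness I (s.reg 5) → (round.den s).reg 18 = 1) := by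
  set S := typeUnion I.G (s.reg 5) with hSdef
  have hf₁ := decode.frame_den s
  have hp₁ := hf₁.presents hs rfl
  have hS₁ := den_decode hs hrep
  set s₁ := decode.den s
  have hf₂ := components.frame_den s₁
  have hp₂ := hf₂.presents hp₁ rfl
  have hl := den_components (S := S) (Fin k) hp₁ hS₁
  set s₂ := components.den s₁
  have hf₃ := total.frame_den s₂
  have hp₃ := hf₃.presents hp₂ rfl
  obtain ⟨⟨a, ha⟩, hall⟩ := den_total (S := S) hp₂ fun v => by
    rw [hf₂.2 3 rfl, hf₂.2 2 rfl, hS₁]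
  set s₃ := total.den s₂
  have h18 : s₃.reg 18 = s.reg 18 := by rw [hf₃.1 18 rfl, hf₂.1 18 rfl, hf₁.1 18 rfl]
  -- The integer `ℓ` is the difference of registers `1` and `2`; moving the negative part to the
  -- other side makes truncated subtraction decide the comparison.
  have hcond : (Expr.sub (.reg 1) (.add (.reg 13) (.reg 2))).eval s₃ ≠ 0 ↔
      ¬ I.ℓ ≤ (s₃.reg 13 : ℤ) := by
    simp only [Expr.eval, hp₃.reg_one, hp₃.reg_two]
    omega
  have hround : round.den s = if (Expr.sub (.reg 1) (.add (.reg 13) (.reg 2))).eval s₃ ≠ 0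
    then s₃ else s₃.setReg 18 1 := rfl
  rw [hround]
  by_cases hle : I.ℓ ≤ (s₃.reg 13 : ℤ)
  · rw [if_neg (by rwa [hcond, not_not])]
    refine ⟨.inr ⟨by simp, ?_⟩, fun _ => by simp⟩
    obtain ⟨c', hc', hle'⟩ := exists_coloring_of_score (c := I.c)
      (fun v hv u hu => hl.eq_of_adj v hv u hu trivial) a I.n
    exact ⟨c', hc', hle.trans (Int.ofNat_le.2 (ha.trans hle'))⟩
  · rw [if_pos (hcond.2 hle)]
    refine ⟨.inl h18, fun ⟨c', hc', hlc, hhS, hSh⟩ => absurd ?_ hle⟩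
    obtain ⟨b, hb⟩ := exists_score_of_coloring hc' hhS hSh hl.eq_of_eq I.n hl.lt
    exact hlc.trans (Int.ofNat_le.2 (hb.trans (hall b)))

open Classical in
theorem den_search (hs : Presents I s) (hrep : ∀ v : Fin I.n, s.arr 2 v = typeRep I.G v)
    (h4 : s.reg 4 = 2 ^ (typeReps I.G).ncard) (h18 : s.reg 18 = 0) [Nonempty (Fin k)] :
    (search.den s).reg 18 = if I.IsYes then 1 else 0 := by
  have := den_count_induct (r := 5) (b := 4) (P := round) (s := s)
    (fun i s' => (s'.reg 18 = 0 ∨ s'.reg 18 = 1 ∧ I.IsYes) ∧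
      ((∃ m < i, IsWitness I m) → s'.reg 18 = 1)) (by simp [h18]) ?_
  · rw [h4] at this
    obtain ⟨h, h'⟩ := this
    change (search.den s).reg 18 = 0 ∨ (search.den s).reg 18 = 1 ∧ I.IsYes at h
    by_cases hy : I.IsYes
    · rw [if_pos hy]
      exact h' hy.exists_isWitness
    · rw [if_neg hy]
      exact h.resolve_right fun h => hy h.2
  · intro i _ s' hr hfr ⟨h, h'⟩
    obtain ⟨hround, hwit⟩ := den_round (hfr.presents hs rfl) fun v => by rw [hfr.2 2 rfl, hrep]
    rw [hr] at hwit
    rw [Store.setReg_reg, if_neg (by decide)]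
    refine ⟨?_, fun ⟨m, hm, hmw⟩ => ?_⟩
    · rcases hround with h1 | h1
      · rw [h1]
        exact h
      · exact .inr h1
    · rcases Nat.lt_succ_iff_lt_or_eq.1 hm with hm | rfl
      · have h1 := h' ⟨m, hm, hmw⟩
        rcases hround with h2 | h2
        · exact h2.trans h1
        · exact h2.1
      · exact hwit hmw

end LProg

/-- The algorithm as a program for the random access machine. -/
def solver (k : ℕ) : Program :=
  .seq (.assign 3 (.const k))
    (.seq LProg.prepare.compile (.seq LProg.search.compile (.assign 0 (.reg 18))))

/-! ### The initial memory -/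

section Input

variable {k : ℕ} (I : MHVInstance k)

theorem presents_input : Presents I (I.input.setReg 3 k) where
  reg_zero := by simp [MHVInstance.input]
  reg_one := by simp [MHVInstance.input]
  reg_two := by simp [MHVInstance.input]
  reg_three := by simp
  adj u v := by
    have : (∃ u' v' : Fin I.n, (u : ℕ) * I.n + v = u' * I.n + v' ∧ I.G.Adj u' v') ↔
        I.G.Adj u v := by
      refine ⟨fun ⟨u', v', h, hadj⟩ => ?_, fun h => ⟨u, v, rfl, h⟩⟩
      have hn : 0 < I.n := u.pos
      have hu := congrArg (· / I.n) h
      have hv := congrArg (· % I.n) h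
      simp only [Nat.mul_add_mod_self_right, Nat.mod_eq_of_lt v.2, Nat.mod_eq_of_lt v'.2] at hv
      rw [hv] at h
      have hu : (u : ℕ) = u' := Nat.eq_of_mul_eq_mul_right hn (Nat.add_right_cancel h)
      rwa [Fin.ext hu, Fin.ext hv]
    simp only [Store.setReg_arr, MHVInstance.input, if_true]
    classical exact if_congr this rfl rfl
  color v := by
    simp only [Store.setReg_arr, MHVInstance.input, one_ne_zero, if_false, if_true, Fin.is_lt,
      dif_pos, Fin.eta]
    rcases I.c v with _ | a <;> rfl

theorem bounded_input : (I.input.setReg 3 k).Bounded (I.n + I.ℓ.natAbs + (k + 2)) := by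
  have hm : ∀ o : Option (Fin k), (match o with | none => 0 | some a => (a : ℕ) + 1) ≤ k := by
    rintro (_ | a)
    · exact Nat.zero_le _
    · exact a.2
  refine Store.Bounded.setReg ⟨fun r => ?_, fun A i => ?_⟩ 3 (by omega)
  · simp only [MHVInstance.input]
    split_ifs <;> omega
  · simp only [MHVInstance.input]
    split_ifs
    · omega
    · omega
    · exact (hm _).trans (by omega)
    · omega
    · omega

end Input

theorem eval_nat_mono (q : Polynomial ℕ) : Monotone fun x => q.eval x := by
  intro x y h
  simp only [Polynomial.eval_eq_sum_range]
  gcongr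

end HappyColoring

/-! ### Assembly of the time bound -/

open HappyColoring in
theorem mainTheorem10 (k : ℕ) (hk : 1 ≤ k) :
    ∃ (P : HappyColoring.Program) (p : Polynomial ℕ),
      HappyColoring.SolvesMHV k P
        (fun I => 2 ^ HappyColoring.neighborhoodDiversity I.G * p.eval I.size) := by
  obtain ⟨C₁, hC₁⟩ := LProg.prepare.exists_exec rfl
  obtain ⟨C₂, hC₂⟩ := LProg.search.exists_exec rfl
  obtain ⟨q₁, hq₁⟩ := LProg.prepare.exists_steps_eq_eval
  obtain ⟨q₂, hq₂⟩ := LProg.round.exists_steps_eq_eval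
  set U : Polynomial ℕ := .X + .C (k + 5) + q₁ with hU
  set B : Polynomial ℕ := q₂.comp (.X + .C k) with hB
  -- `U` bounds the bit length of the values after the preparation, and `B` the steps of one round.
  -- The constant `k + 5` pays for the first and the last assignment.
  refine ⟨solver k, .C (k + 5) + .C C₁ * q₁ * U + .C C₂ * (B + 4) * (U + .X + B + 6), fun I => ?_⟩
  have : Nonempty (Fin k) := ⟨⟨0, hk⟩⟩
  set M := I.n + I.ℓ.natAbs + (k + 2) with hM
  set s₀ := I.input.setReg 3 k with hs₀
  have hp₀ : Presents I s₀ := presents_input I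
  have hprep : ∀ x, LProg.prepare.isBound x → x = 0 := fun x hx => by
    simpa [LProg.isBound, LProg.prepare, LProg.findRep, LProg.compareTypes, LProg.allZero] using hx
  have hround : ∀ x, LProg.round.isBound x → x = 0 ∨ x = 3 := fun x hx => by
    simp [LProg.isBound, LProg.round, LProg.decode, LProg.components, LProg.merge, LProg.relabel,
      LProg.total, LProg.bestColor, LProg.fillColor, LProg.countHappy, LProg.checkHappy,
      LProg.allZero] at hx
    tauto
  have hsearch : ∀ x, LProg.search.isBound x → x = 4 ∨ x = 0 ∨ x = 3 := fun x hx => by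
    rw [LProg.search, LProg.isBound, Bool.or_eq_true, beq_iff_eq] at hx
    exact hx.imp_right (hround x)
  have hsteps₁ : LProg.prepare.steps (fun _ => I.n) = q₁.eval I.n := hq₁ _ _ fun _ _ => rfl
  obtain ⟨hb₁, T₁, he₁, hT₁⟩ := hC₁ Expr.doubling (fun j => M * 2 ^ j) (fun _ => I.n)
    (M * 2 ^ q₁.eval I.n) 0 s₀ (isGrowthBound_mul_pow (by omega)) rfl
    (fun x hx => by rw [hprep x hx]; rfl)
    (fun x hx => by rw [hprep x hx]; exact hp₀.reg_zero.le) (by simpa using bounded_input I)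
    (by rw [zero_add, hsteps₁]) (Nat.mul_pos (by omega) (by positivity))
  rw [zero_add, hsteps₁] at hb₁
  rw [hsteps₁] at hT₁
  have hf₁ := LProg.prepare.frame_den s₀
  have hp₁ : Presents I (LProg.prepare.den s₀) := hf₁.presents hp₀ rfl
  obtain ⟨h4, hrep⟩ := LProg.den_prepare hp₀
  have h18 : (LProg.prepare.den s₀).reg 18 = 0 := by
    rw [hf₁.1 18 rfl]
    simp [hs₀, MHVInstance.input]
  set s₁ := LProg.prepare.den s₀
  set r := (typeReps I.G).ncard with hr
  -- Only the outermost loop, bounded by register `4`, is exponential; `n + k` is a common bound for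
  -- the loops over vertices and colors.
  set N : ℕ → ℕ := fun x => if x = 4 then 2 ^ r else I.n + k with hN
  have hsteps₂ : LProg.search.steps N = 2 + 2 ^ r * (q₂.eval (I.n + k) + 2) := by
    rw [LProg.search, LProg.steps, hq₂ N (I.n + k)]
    · simp [hN]
    · intro x hx
      rcases hround x hx with rfl | rfl <;> simp [hN]
  set W₁ := M * 2 ^ q₁.eval I.n with hW₁
  obtain ⟨-, T₂, he₂, hT₂⟩ := hC₂ Expr.slow (fun j => W₁ + j) N (W₁ + LProg.search.steps N) 0 s₁
    (isGrowthBound_add (Nat.mul_pos (by omega) (by positivity))) rfl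
    (fun x hx => by rcases hsearch x hx with rfl | rfl | rfl <;> rfl)
    (fun x hx => by
      rcases hsearch x hx with rfl | rfl | rfl
      · rw [h4]; simp [hN]
      · rw [hp₁.reg_zero]; simp [hN]
      · rw [hp₁.reg_three]; simp [hN])
    (by simpa using hb₁) (by simp)
    ((Nat.mul_pos (by omega) (by positivity)).trans_le (Nat.le_add_right _ _))
  have hans := LProg.den_search hp₁ hrep h4 h18
  set s₂ := LProg.search.den s₁
  refine ⟨_, _, .seq (.assign 3 (.const k) I.input) (.seq he₁ (.seq he₂ (.assign 0 (.reg 18) s₂))),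
    by simpa [Expr.eval] using hans, ?_⟩
  have hlast : (Expr.reg 18).cost s₂ ≤ 2 := by
    have : s₂.reg 18 ≤ 1 := by rw [hans]; split_ifs <;> omega
    have := (size_le_self (s₂.reg 18)).trans this
    simp only [Expr.cost]
    omega
  have hfirst : (Expr.const k).cost I.input ≤ 1 + k := by
    have := size_le_self k
    simp only [Expr.cost]
    omega
  have hrt : r ≤ neighborhoodDiversity I.G := ncard_typeReps_le
  have hrn : r ≤ I.n := ncard_typeReps_le_card
  change _ ≤ 2 ^ neighborhoodDiversity I.G * Polynomial.eval I.size _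
  obtain ⟨x, hx⟩ : ∃ x, x = I.size := ⟨_, rfl⟩
  rw [← hx]
  replace hx : x = I.n + Nat.size I.ℓ.natAbs := hx
  have hA : q₁.eval I.n ≤ q₁.eval x := eval_nat_mono q₁ (by omega)
  have hBx : q₂.eval (I.n + k) ≤ B.eval x := by
    rw [hB, Polynomial.eval_comp]
    exact eval_nat_mono q₂ (by simp; omega)
  have hUx : U.eval x = x + (k + 5) + q₁.eval x := by simp [hU]
  have hMsize : Nat.size M ≤ x + k + 4 := by
    have h1 := size_add_le (I.n + I.ℓ.natAbs) (k + 2)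
    have h2 := size_add_le I.n I.ℓ.natAbs
    rw [← hM] at h1
    have h3 := size_le_self I.n
    have h4 := size_le_self (k + 2)
    omega
  have hW₁size : Nat.size W₁ ≤ U.eval x := by
    have := size_mul_le M (2 ^ q₁.eval I.n)
    rw [Nat.size_pow, ← hW₁] at this
    omega
  have hsteps : LProg.search.steps N ≤ 2 ^ r * (B.eval x + 4) := by
    have h1 : 1 ≤ 2 ^ r := Nat.one_le_two_pow
    rw [hsteps₂]
    nlinarith
  -- The exponential factor `2 ^ r` contributes only `r + 1` bits, and `r ≤ n ≤ x`.
  have hW₂size : Nat.size (W₁ + LProg.search.steps N) ≤ U.eval x + x + B.eval x + 6 := by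
    have h1 := size_add_le W₁ (LProg.search.steps N)
    have h2 := Nat.size_le_size hsteps
    have h3 := size_mul_le (2 ^ r) (B.eval x + 4)
    have h4 := size_le_self (B.eval x + 4)
    rw [Nat.size_pow] at h3
    omega
  have h₁ : T₁ ≤ C₁ * q₁.eval x * U.eval x :=
    hT₁.trans (Nat.mul_le_mul (Nat.mul_le_mul_left _ hA) hW₁size)
  have h₂ : T₂ ≤ 2 ^ r * (C₂ * (B.eval x + 4) * (U.eval x + x + B.eval x + 6)) := by
    refine hT₂.trans ((Nat.mul_le_mul (Nat.mul_le_mul_left _ hsteps) hW₂size).trans_eq ?_)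
    ring
  have hpow : 2 ^ r ≤ 2 ^ neighborhoodDiversity I.G := Nat.pow_le_pow_right (by norm_num) hrt
  refine le_trans ?_ (Nat.mul_le_mul_right _ hpow)
  have h1 : 1 ≤ 2 ^ r := Nat.one_le_two_pow
  simp only [Polynomial.eval_add, Polynomial.eval_mul, Polynomial.eval_C, Polynomial.eval_X,
    Polynomial.eval_ofNat]
  have h3 : k + 5 + C₁ * q₁.eval x * U.eval x ≤
      2 ^ r * (k + 5 + C₁ * q₁.eval x * U.eval x) := Nat.le_mul_of_pos_left _ h1
  rw [mul_add]
  omega
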